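/- Let $\Gamma \subset \mathrm{PSL}_2(\mathbb{C}) \cong \mathrm{Isom}^+(\mathbb{H}^3)$ be a discrete torsion-free subgroup with compact quotient, and let $M = \mathbb{H}^3/\Gamma$ be the corresponding closed orientable hyperbolic 3-manifold. Let $\widetilde\Gamma \subset \mathrm{SL}_2(\mathbb{C})$ be the preimage of $\Gamma$, let $k = \mathbb{Q}(\mathrm{tr}\,\gamma : \gamma \in \widetilde\Gamma)$ be the trace field of $M$, and let $A_0(M) = \{\sum a_i \gamma_i : a_i \in k,\ \gamma_i \in \widetilde\Gamma\} \subset M_2(\mathbb{C})$ be the (non-invariant) quaternion algebra of $M$ over $k$. Let $p$ be a prime number and suppose that $A_0(M)$ ramifies at a finite prime $\mathfrak{p}$ of $k$ of norm $p^n$, i.e. $k_{\mathfrak{p}} \otimes_k A_0(M)$ is a division algebra, where $k_{\mathfrak{p}}$ is the completion of $k$ at $\mathfrak{p}$ and the residue field of $\mathfrak{p}$ has $p^n$ elements. Suppose that $\beta_1(M) = \dim H^1(M;\mathbb{Q}) = 0$, that $|H_1(M;\mathbb{Z})|$ is coprime to $p^{2n}-1$, and that $\pi_1(M)$ is $p$-powerful,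 i.e. every finite $p$-group quotient $S$ of $\pi_1(M)$ is powerful: $S/S^p$ is abelian if $p$ is odd, and $S/S^4$ is abelian if $p = 2$, where $S^m$ is the subgroup generated by all $m$-th powers. Then $M$ can be exhausted by rational homology spheres: there is a tower of finite covers $M = M_0 \leftarrow M_1 \leftarrow M_2 \leftarrow \cdots$ with $\beta_1(M_k) = 0$ for all $k$ and $\mathrm{injrad}(M_k) \to \infty$ as $k \to \infty$. Here $\mathrm{injrad}(N)$ is the supremum of the radii $r$ such that a ball of radius $r$ is embedded around every point of $N$. -/

import Mathlib

noncomputable section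

namespace HypMfd

open scoped MatrixGroups ComplexOrder NNReal ENNReal TensorProduct
open Matrix

/-! ### Hyperbolic 3-space and the action of `PSL(2, ℂ)` -/

/-- The group `SL(2, ℂ)`. -/
abbrev SL2C : Type := Matrix.SpecialLinearGroup (Fin 2) ℂ

/-- The group `PSL(2, ℂ) = SL(2, ℂ) / {± 1}`, with the quotient topology. It is the group of
orientation preserving isometries of hyperbolic 3-space. -/
abbrev PSL2C : Type := Matrix.ProjectiveSpecialLinearGroup (Fin 2) ℂ

/-- Hyperbolic 3-space `ℍ³` in the hyperboloid model. The determinant is a quadratic form of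
signature `(1, 3)` on the real vector space of Hermitian `2 × 2` matrices; `ℍ³` is the
positive sheet of `det = 1`, that is, the set of positive definite Hermitian matrices of
determinant one. It carries the subspace topology. -/
def H3 : Type := {P : Matrix (Fin 2) (Fin 2) ℂ // P.PosDef ∧ P.det = 1}

instance : TopologicalSpace H3 :=
  inferInstanceAs (TopologicalSpace {P : Matrix (Fin 2) (Fin 2) ℂ // P.PosDef ∧ P.det = 1})

/-- The hyperbolic distance (curvature `-1`): `cosh d(P, Q) = ⟨P, Q⟩`, where
`⟨P, Q⟩ = tr (P⁻¹ Q) / 2` is the polarization of `det` on matrices of determinant one. -/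
def hdist (P Q : H3) : ℝ :=
  Real.arcosh ((Matrix.trace (P.1⁻¹ * Q.1)).re / 2)

/-- `SL(2, ℂ)` acts on `ℍ³` by `g • P = g P gᴴ`. -/
instance : MulAction SL2C H3 where
  smul g P := ⟨g.1 * P.1 * g.1ᴴ,
    P.2.1.mul_mul_conjTranspose_same (by
      rw [Matrix.vecMul_injective_iff_isUnit, Matrix.isUnit_iff_isUnit_det, g.2]
      exact isUnit_one),
    by rw [Matrix.det_mul, Matrix.det_mul, Matrix.det_conjTranspose, g.2, P.2.2]; simp⟩
  one_smul P := Subtype.ext (by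
    change (1 : Matrix (Fin 2) (Fin 2) ℂ) * P.1 * (1 : Matrix (Fin 2) (Fin 2) ℂ)ᴴ = P.1
    simp)
  mul_smul g h P := Subtype.ext (by
    change (g.1 * h.1) * P.1 * (g.1 * h.1)ᴴ = g.1 * (h.1 * P.1 * h.1ᴴ) * g.1ᴴ
    simp [Matrix.conjTranspose_mul, Matrix.mul_assoc])

/-- The centre of `SL(2, ℂ)` acts trivially on `ℍ³`. -/
theorem center_le_ker :
    Subgroup.center SL2C ≤ (MulAction.toPermHom SL2C H3).ker := by
  intro g hg
  obtain ⟨r, hr, hrg⟩ := Matrix.SpecialLinearGroup.mem_center_iff.1 hg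
  have h2 : r * star r = 1 := by
    simp only [Fintype.card_fin] at hr
    rcases sq_eq_sq_iff_eq_or_eq_neg.1 (hr.trans (one_pow 2).symm) with h | h <;> simp [h]
  rw [MonoidHom.mem_ker]
  ext P
  apply Subtype.ext
  change g.1 * P.1 * g.1ᴴ = P.1
  rw [← hrg, Matrix.scalar_apply, ← Matrix.smul_one_eq_diagonal, Matrix.conjTranspose_smul,
    Matrix.conjTranspose_one]
  simp only [Matrix.smul_mul, Matrix.mul_smul, one_mul, mul_one, smul_smul]
  rw [mul_comm, h2, one_smul]

/-- The action of `PSL(2, ℂ)` on `ℍ³` induced by that of `SL(2, ℂ)`. -/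
instance : MulAction PSL2C H3 :=
  MulAction.compHom H3
    (QuotientGroup.lift (Subgroup.center SL2C) (MulAction.toPermHom SL2C H3) center_le_ker)

/-- The quotient space `ℍ³ / Γ`, with the quotient topology. -/
abbrev Mfd (Γ : Subgroup PSL2C) : Type := MulAction.orbitRel.Quotient Γ H3

/-- `ℍ³ / Γ` is a closed orientable hyperbolic 3-manifold: `Γ` is a discrete torsion-free subgroup
of `PSL(2, ℂ)` with compact quotient, that is, a torsion-free uniform lattice. -/
structure IsClosedHyperbolic (Γ : Subgroup PSL2C) : Prop where
  discrete : DiscreteTopology Γ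
  torsionFree : ∀ g ∈ Γ, IsOfFinOrder g → g = 1
  compact : CompactSpace (Mfd Γ)

/-- The injectivity radius of `ℍ³ / Γ`: the supremum of all `r` such that the ball of radius `r`
around every point is embedded, that is, every open ball of radius `r` of `ℍ³` is mapped
injectively to `ℍ³ / Γ`. -/
def injRad (Γ : Subgroup PSL2C) : ℝ≥0∞ :=
  ⨆ (r : ℝ≥0) (_ : ∀ x : H3, Set.InjOn (fun y : H3 => (Quotient.mk'' y : Mfd Γ))
    {y | hdist x y < r}), (r : ℝ≥0∞)

/-! ### Singular homology and cohomology -/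

/-- The singular `n`-simplices of `X`. -/
abbrev Simp (X : Type) [TopologicalSpace X] (n : ℕ) : Type := C(stdSimplex ℝ (Fin (n + 1)), X)

/-- The `i`-th face of a singular simplex. -/
def face {X : Type} [TopologicalSpace X] {n : ℕ} (i : Fin (n + 2)) (σ : Simp X (n + 1)) :
    Simp X n :=
  σ.comp ⟨stdSimplex.map i.succAbove, stdSimplex.continuous_map _⟩

/-- The boundary map `C_{n+1}(X; R) → C_n(X; R)` of the singular chain complex. -/
def boundary (R : Type) [CommRing R] (X : Type) [TopologicalSpace X] (n : ℕ) :
    (Simp X (n + 1) →₀ R) →ₗ[R] (Simp X n →₀ R) :=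
  Finsupp.lift _ R _ fun σ => ∑ i : Fin (n + 2), (-1 : R) ^ (i : ℕ) • Finsupp.single (face i σ) 1

/-- The coboundary map `C^n(X; R) → C^{n+1}(X; R)` of the singular cochain complex. -/
def coboundary (R : Type) [CommRing R] (X : Type) [TopologicalSpace X] (n : ℕ) :
    (Simp X n → R) →ₗ[R] (Simp X (n + 1) → R) :=
  LinearMap.pi fun σ => ∑ i : Fin (n + 2), (-1 : R) ^ (i : ℕ) • LinearMap.proj (face i σ)

/-- The first singular homology group `H_1(X; ℤ)`: cycles modulo boundaries. -/
abbrev H1 (X : Type) [TopologicalSpace X] : Type :=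
  (LinearMap.ker (boundary ℤ X 0)) ⧸
    (LinearMap.range (boundary ℤ X 1)).submoduleOf (LinearMap.ker (boundary ℤ X 0))

/-- The first singular cohomology group `H^1(X; ℚ)`: cocycles modulo coboundaries. -/
abbrev cohomH1 (X : Type) [TopologicalSpace X] : Type :=
  (LinearMap.ker (coboundary ℚ X 1)) ⧸
    (LinearMap.range (coboundary ℚ X 0)).submoduleOf (LinearMap.ker (coboundary ℚ X 1))

/-- The first Betti number `β₁(X) = dim H^1(X; ℚ)`, as a cardinal. -/
def betti1 (X : Type) [TopologicalSpace X] : Cardinal := Module.rank ℚ (cohomH1 X)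

/-! ### The quaternion algebra of a Kleinian group -/

/-- The preimage of `Γ` in `SL(2, ℂ)`. -/
def lift (Γ : Subgroup PSL2C) : Subgroup SL2C :=
  Γ.comap (QuotientGroup.mk' (Subgroup.center SL2C))

/-- The trace field `ℚ(tr Γ)`. -/
def traceField (Γ : Subgroup PSL2C) : IntermediateField ℚ ℂ :=
  IntermediateField.adjoin ℚ {t | ∃ g ∈ lift Γ, t = Matrix.trace g.1}

/-- The (non-invariant) quaternion algebra `A₀(Γ)`: the subalgebra over the trace field of the
algebra of `2 × 2` matrices that is generated by (equivalently, as `Γ` is a group, spanned by)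
the elements of `Γ`. -/
def quatAlg (Γ : Subgroup PSL2C) : Subalgebra (traceField Γ) (Matrix (Fin 2) (Fin 2) ℂ) :=
  Algebra.adjoin (traceField Γ) {m | ∃ g ∈ lift Γ, m = g.1}

/-- The completion of a field `K` at a valuation ring of `K` is a `K`-algebra through the canonical
embedding. -/
instance completionAlgebra {K : Type} [Field K] (V : ValuationSubring K) :
    Algebra K V.valuation.Completion :=
  ((algebraMap (WithVal V.valuation) V.valuation.Completion).comp
    (WithVal.equiv V.valuation).symm.toRingHom).toAlgebra

/-- The quaternion algebra `A₀(Γ)` ramifies at a prime of norm `q`. A finite prime of the trace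
field `k` is given by its discrete valuation ring `V ⊆ k` (for a number field these rings are
exactly the localizations of the ring of integers at the nonzero prime ideals, and the norm is the
cardinality of the residue field); the algebra ramifies at `V` if its base change to the completion
of `k` at `V` is a division algebra. -/
def RamifiesAtPrimeOfNorm (Γ : Subgroup PSL2C) (q : ℕ) : Prop :=
  ∃ V : ValuationSubring (traceField Γ),
    IsDiscreteValuationRing V ∧ Nat.card (IsLocalRing.ResidueField V) = q ∧
    ∀ a : V.valuation.Completion ⊗[traceField Γ] quatAlg Γ, a ≠ 0 → IsUnit a

/-! ### Powerful groups -/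

/-- A finite `p`-group `S` is powerful if `S / S^p` is abelian (`S / S^4` if `p = 2`), where `S^m`
is the subgroup generated by all `m`-th powers. -/
def IsPowerful (p : ℕ) (S : Type) [Group S] : Prop :=
  commutator S ≤ Subgroup.closure (Set.range fun s : S => s ^ (if p = 2 then 4 else p))

/-- A group is `p`-powerful if all its finite `p`-group quotients are powerful. -/
def IsPPowerful (p : ℕ) (G : Type) [Group G] : Prop :=
  ∀ (N : Subgroup G) [N.Normal], Finite (G ⧸ N) → IsPGroup p (G ⧸ N) → IsPowerful p (G ⧸ N)

/-! ### Exhaustion by rational homology spheres -/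

/-- `M = ℍ³ / Γ` can be exhausted by rational homology spheres: there is a tower
`M = M₀ ← M₁ ← M₂ ← ⋯` of finite covers `M_k = ℍ³ / Λ_k`, given by a decreasing sequence of
subgroups `Λ_k` of finite index in `Γ`, with `β₁(M_k) = 0` for all `k` and injectivity radius
tending to infinity. -/
def ExhaustedByRationalHomologySpheres (Γ : Subgroup PSL2C) : Prop :=
  ∃ Λ : ℕ → Subgroup PSL2C, Λ 0 = Γ ∧ Antitone Λ ∧ (∀ k, (Λ k).IsFiniteRelIndex Γ) ∧
    (∀ k, betti1 (Mfd (Λ k)) = 0) ∧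
    Filter.Tendsto (fun k => injRad (Λ k)) Filter.atTop (nhds ⊤)

end HypMfd

end

/-!
At a ramified prime the completion of `A₀` is a division algebra, so `a ↦ v (nrd a)` is a valuation
on `A₀`, where `v` is the valuation of the prime. Elements of the preimage of `Γ` in `SL(2, ℂ)` have
reduced norm `1`, so they are units of its valuation ring. The residue ring is commutative and each
of its elements is quadratic over the residue field with `pⁿ` elements, so its unit group is killed
by `p ^ (2 * n) - 1`; since `|H₁(M)|` is coprime to this number and kills the abelianization of `Γ`,
every element of the preimage is congruent to `±1` modulo the maximal ideal. The congruence
subgroups modulo its powers therefore form a filtration `Λ_k` of `Γ` with trivial intersection and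
quotients of exponent a power of `p`.

Suppose that some `Λ_k` had a nonzero rational character. Dividing `Γ` by the common kernel of all
characters of `Λ_k` gives a `p`-powerful extension of a finite `p`-group by a lattice. Powerfulness
forces an iterated power subgroup inside the lattice to be acted on by conjugation trivially modulo
`p` (modulo `4` if `p = 2`), and by Minkowski's lemma the finite-order action is then trivial, so a
central subgroup of finite index remains. Transfer extends its characters, up to a power, to `Γ`,
contradicting `β₁(M) = 0`. Finally, a cocompact group has only finitely many elements of bounded
displacement up to conjugacy, and each nontrivial one eventually leaves the normal subgroups `Λ_k`,
so the injectivity radius of the covers tends to infinity.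
-/

namespace HypMfd

open Subgroup Topology
open scoped commutatorElement IsMulCommutative

/-! ### Power subgroups and powerful embeddings -/

section PowerSubgroup

variable {G : Type*} [Group G]

/-- The subgroup `N ^ m` generated by the `m`-th powers of the elements of `N`. -/
def powerSubgroup (N : Subgroup G) (m : ℕ) : Subgroup G :=
  closure ((· ^ m) '' (N : Set G))

theorem pow_mem_powerSubgroup {N : Subgroup G} {x : G} (hx : x ∈ N) (m : ℕ) :
    x ^ m ∈ powerSubgroup N m :=
  subset_closure ⟨x, hx, rfl⟩

theorem powerSubgroup_le_iff {N K : Subgroup G} {m : ℕ} :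
    powerSubgroup N m ≤ K ↔ ∀ x ∈ N, x ^ m ∈ K := by
  rw [powerSubgroup, closure_le]
  exact Set.forall_mem_image

theorem powerSubgroup_le_self (N : Subgroup G) (m : ℕ) : powerSubgroup N m ≤ N :=
  powerSubgroup_le_iff.2 fun _ hx => N.pow_mem hx m

theorem map_powerSubgroup {H : Type*} [Group H] (f : G →* H) (N : Subgroup G) (m : ℕ) :
    (powerSubgroup N m).map f = powerSubgroup (N.map f) m := by
  simp only [powerSubgroup, MonoidHom.map_closure, coe_map, Set.image_image, map_pow]

instance powerSubgroup_normal (N : Subgroup G) [N.Normal] (m : ℕ) : (powerSubgroup N m).Normal :=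
  normal_iff_map_conj_eq.2 fun g => by rw [map_powerSubgroup, Normal.map_conj_eq]

theorem exists_pow_eq_of_mem_powerSubgroup {N : Subgroup G} [IsMulCommutative N] {m : ℕ} {x : G}
    (hx : x ∈ powerSubgroup N m) : ∃ a ∈ N, a ^ m = x := by
  induction hx using closure_induction with
  | mem _ hy => exact hy
  | one => exact ⟨1, N.one_mem, one_pow m⟩
  | mul y z _ _ ihy ihz =>
    obtain ⟨a, ha, rfl⟩ := ihy
    obtain ⟨b, hb, rfl⟩ := ihz
    have hab : Commute a b := setLike_mul_comm ha hb
    exact ⟨a * b, N.mul_mem ha hb, hab.mul_pow m⟩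
  | inv y _ ihy =>
    obtain ⟨a, ha, rfl⟩ := ihy
    exact ⟨a⁻¹, N.inv_mem ha, inv_pow a m⟩

theorem pow_eq_one_of_mem_powerSubgroup {N : Subgroup G} {m k : ℕ}
    (hN : powerSubgroup N m ≤ center G) (h : ∀ x ∈ N, (x ^ m) ^ k = 1) {y : G}
    (hy : y ∈ powerSubgroup N m) : y ^ k = 1 := by
  induction hy using closure_induction with
  | mem y hy =>
    obtain ⟨x, hx, rfl⟩ := hy
    exact h x hx
  | one => exact one_pow k
  | mul y z _ hz ihy ihz =>
    have hyz : Commute y z := mem_center_iff.1 (hN hz) y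
    rw [hyz.mul_pow, ihy, ihz, one_mul]
  | inv y _ ihy => rw [inv_pow, ihy, inv_one]

theorem map_mk'_le_center_iff {K M : Subgroup G} [K.Normal] :
    M.map (QuotientGroup.mk' K) ≤ center (G ⧸ K) ↔ ⁅M, (⊤ : Subgroup G)⁆ ≤ K := by
  rw [← commutator_top_right_eq_bot_iff_le_center,
    ← map_top_of_surjective _ (QuotientGroup.mk'_surjective K), ← map_commutator,
    Subgroup.map_eq_bot_iff, QuotientGroup.ker_mk']

theorem powerSubgroup_le_center_of_forall_conj_eq {N : Subgroup G} {m : ℕ}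
    (h : ∀ x ∈ N, ∀ g : G, g * x ^ m * g⁻¹ = x ^ m) : powerSubgroup N m ≤ center G :=
  powerSubgroup_le_iff.2 fun x hx => mem_center_iff.2 fun g => mul_inv_eq_iff_eq_mul.1 (h x hx g)

theorem conj_eq_mul_commutatorElement (x g : G) : g * x * g⁻¹ = x * ⁅x⁻¹, g⁆ := by
  simp [commutatorElement_def, mul_assoc]

theorem mul_pow_of_commutatorElement_mem_center {x d : G} (hz : ⁅d⁻¹, x⁻¹⁆ ∈ center G) (n : ℕ) :
    (x * d) ^ n = x ^ n * d ^ n * ⁅d⁻¹, x⁻¹⁆ ^ n.choose 2 := by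
  set z := ⁅d⁻¹, x⁻¹⁆ with hz_def
  have central (k : ℕ) (g : G) : Commute (z ^ k) g :=
    (Commute.symm (mem_center_iff.1 hz g)).pow_left k
  have hdx : d * x = x * d * z := by simp [hz_def, commutatorElement_def, mul_assoc]
  have pow_swap (k : ℕ) : d ^ k * x = x * d ^ k * z ^ k := by
    induction k with
    | zero => simp
    | succ k ih =>
      calc d ^ (k + 1) * x = d * x * d ^ k * z ^ k := by
            rw [pow_succ', mul_assoc, ih]; simp only [mul_assoc]
        _ = x * d * (z ^ 1 * d ^ k) * z ^ k := by rw [hdx, pow_one]; simp only [mul_assoc]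
        _ = x * d ^ (k + 1) * z ^ (k + 1) := by
            rw [(central 1 _).eq, pow_succ' d, add_comm k 1, pow_add z]; simp only [mul_assoc]
  induction n with
  | zero => simp
  | succ n ih =>
    calc (x * d) ^ (n + 1) = x ^ n * d ^ n * (z ^ n.choose 2 * (x * d)) := by
          rw [pow_succ, ih, mul_assoc]
      _ = x ^ n * (d ^ n * x) * d * z ^ n.choose 2 := by
          rw [(central _ _).eq]; simp only [mul_assoc]
      _ = x ^ (n + 1) * d ^ n * (z ^ n * d) * z ^ n.choose 2 := by
          rw [pow_swap, pow_succ]; simp only [mul_assoc]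
      _ = x ^ (n + 1) * d ^ (n + 1) * z ^ (n + 1).choose 2 := by
          rw [(central _ _).eq, Nat.choose_succ_succ' n 1, Nat.choose_one_right, pow_add z,
            pow_succ d]
          simp only [mul_assoc]

end PowerSubgroup

/-- The exponent in the definition of powerful `p`-groups. -/
def powerfulExponent (p : ℕ) : ℕ := if p = 2 then 4 else p

theorem dvd_powerfulExponent (p : ℕ) : p ∣ powerfulExponent p := by
  unfold powerfulExponent
  split_ifs with h
  · simp [h]
  · rfl

theorem powerfulExponent_dvd_sq (p : ℕ) : powerfulExponent p ∣ p ^ 2 := by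
  unfold powerfulExponent
  split_ifs with h
  · simp [h]
  · exact dvd_pow_self p two_ne_zero

section PowerfullyEmbedded

variable {G : Type*} [Group G] {p : ℕ}

/-- A normal subgroup `N` of a `p`-group `G` is powerfully embedded if `[N, G] ≤ N ^ p`
(`[N, G] ≤ N ^ 4` if `p = 2`); thus `G` is powerful if it is powerfully embedded in itself. -/
def IsPowerfullyEmbedded (p : ℕ) (N : Subgroup G) : Prop :=
  ⁅N, (⊤ : Subgroup G)⁆ ≤ powerSubgroup N (powerfulExponent p)

theorem isPowerful_iff_isPowerfullyEmbedded_top {S : Type} [Group S] :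
    IsPowerful p S ↔ IsPowerfullyEmbedded p (⊤ : Subgroup S) := by
  rw [IsPowerful, IsPowerfullyEmbedded, powerSubgroup, coe_top, Set.image_univ,
    powerfulExponent, commutator_def]

theorem IsPowerfullyEmbedded.map {H : Type*} [Group H] {N : Subgroup G}
    (hN : IsPowerfullyEmbedded p N) {f : G →* H} (hf : Function.Surjective f) :
    IsPowerfullyEmbedded p (N.map f) := by
  rw [IsPowerfullyEmbedded, ← map_top_of_surjective f hf, ← map_commutator, ← map_powerSubgroup]
  exact map_mono hN

/-- The reduced case of `isPowerfullyEmbedded_powerSubgroup`: writing `g x g⁻¹ = x d`, the power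
`(x d) ^ p` collapses to `x ^ p`. -/
theorem IsPowerfullyEmbedded.powerSubgroup_le_center [hp : Fact p.Prime] {N : Subgroup G}
    (hN : IsPowerfullyEmbedded p N)
    (hpow : ∀ m ∈ powerSubgroup N p, m ^ powerfulExponent p = 1)
    (hcentral : ⁅powerSubgroup N p, (⊤ : Subgroup G)⁆ ≤ center G)
    (hcomm : ∀ c ∈ ⁅powerSubgroup N p, (⊤ : Subgroup G)⁆, c ^ p = 1) :
    powerSubgroup N p ≤ center G := by
  suffices h : ∀ x ∈ N, ∀ g : G, (x * ⁅x⁻¹, g⁆) ^ p = x ^ p from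
    powerSubgroup_le_center_of_forall_conj_eq fun x hx g => by
      rw [← conj_pow, conj_eq_mul_commutatorElement, h x hx g]
  intro x hx g
  have hd : ⁅x⁻¹, g⁆ ∈ powerSubgroup N (powerfulExponent p) :=
    hN (commutator_mem_commutator (N.inv_mem hx) (mem_top g))
  obtain rfl | hp2 := eq_or_ne p 2
  · have hfourth : powerSubgroup N 4 ≤ center G :=
      powerSubgroup_le_center_of_forall_conj_eq fun y hy g => by
        have hc : ⁅(y ^ 2)⁻¹, g⁆ ∈ ⁅powerSubgroup N 2, (⊤ : Subgroup G)⁆ :=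
          commutator_mem_commutator (inv_mem (pow_mem_powerSubgroup hy 2)) (mem_top g)
        have hcommute : Commute (y ^ 2) ⁅(y ^ 2)⁻¹, g⁆ := mem_center_iff.1 (hcentral hc) _
        rw [show y ^ 4 = (y ^ 2) ^ 2 from pow_mul y 2 2, ← conj_pow,
          conj_eq_mul_commutatorElement, hcommute.mul_pow, hcomm _ hc, mul_one]
    have hsq : ⁅x⁻¹, g⁆ ^ 2 = 1 := pow_eq_one_of_mem_powerSubgroup hfourth
      (fun y hy => by
        rw [← hpow _ (pow_mem_powerSubgroup hy 2), ← pow_mul, ← pow_mul, powerfulExponent,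
          if_pos rfl]) hd
    have hcommute : Commute x ⁅x⁻¹, g⁆ := mem_center_iff.1 (hfourth hd) x
    rw [hcommute.mul_pow, hsq, mul_one]
  · rw [powerfulExponent, if_neg hp2] at hd hpow
    have hz : ⁅⁅x⁻¹, g⁆⁻¹, x⁻¹⁆ ∈ ⁅powerSubgroup N p, (⊤ : Subgroup G)⁆ :=
      commutator_mem_commutator (inv_mem hd) (mem_top _)
    obtain ⟨k, hk⟩ : p ∣ p.choose 2 :=
      hp.out.dvd_choose_self two_ne_zero (lt_of_le_of_ne hp.out.two_le hp2.symm)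
    rw [mul_pow_of_commutatorElement_mem_center (hcentral hz), hpow _ hd, hk, pow_mul,
      hcomm _ hz, one_pow, mul_one, mul_one]

end PowerfullyEmbedded

section FinitePGroup

variable {G : Type*} [Group G] {p : ℕ}

theorem commutator_sup_top_le (L K : Subgroup G) [L.Normal] [K.Normal] :
    ⁅L ⊔ K, (⊤ : Subgroup G)⁆ ≤ L ⊔ ⁅K, (⊤ : Subgroup G)⁆ := by
  rw [← map_mk'_le_center_iff, Subgroup.map_sup, (Subgroup.map_eq_bot_iff L).2, bot_sup_eq,
    map_mk'_le_center_iff]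
  · exact le_sup_right
  · rw [QuotientGroup.ker_mk']
    exact le_sup_left

theorem le_of_le_sup_commutator_top [Group.IsNilpotent G] {C L : Subgroup G} [L.Normal]
    (h : C ≤ L ⊔ ⁅C, (⊤ : Subgroup G)⁆) : C ≤ L := by
  have hlower : ∀ n, C ≤ L ⊔ (⊤ : Subgroup G).lowerCentralSeries n := by
    intro n
    induction n with
    | zero => simp
    | succ n ih =>
      exact h.trans (sup_le le_sup_left
        ((commutator_mono ih le_rfl).trans (commutator_sup_top_le _ _)))
  obtain ⟨n, hn⟩ := Subgroup.nilpotent_iff_lowerCentralSeries.1 ‹Group.IsNilpotent G›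
  simpa only [hn, sup_bot_eq] using hlower n

theorem eq_bot_of_le_powerSubgroup [Finite G] [Fact p.Prime] (hG : IsPGroup p G)
    {C : Subgroup G} [IsMulCommutative C] (h : C ≤ powerSubgroup C p) : C = ⊥ := by
  have hdiv : ∀ n : ℕ, ∀ c ∈ C, ∃ a ∈ C, a ^ p ^ n = c := by
    intro n
    induction n with
    | zero => exact fun c hc => ⟨c, hc, by simp⟩
    | succ n ih =>
      intro c hc
      obtain ⟨b, hb, rfl⟩ := exists_pow_eq_of_mem_powerSubgroup (h hc)
      obtain ⟨a, ha, rfl⟩ := ih b hb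
      exact ⟨a, ha, by rw [pow_succ, pow_mul]⟩
  obtain ⟨n, hn⟩ := IsPGroup.iff_card.1 hG
  refine (eq_bot_iff_forall C).2 fun c hc => ?_
  obtain ⟨a, -, rfl⟩ := hdiv n c hc
  rw [← hn, pow_card_eq_one']

theorem le_of_le_sup_commutator_sup_powerSubgroup [Finite G] [Fact p.Prime] (hG : IsPGroup p G)
    {C L : Subgroup G} [C.Normal] [L.Normal]
    (h : C ≤ L ⊔ ⁅C, (⊤ : Subgroup G)⁆ ⊔ powerSubgroup C p) : C ≤ L := by
  have := hG.isNilpotent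
  refine le_of_le_sup_commutator_top ?_
  set K := L ⊔ ⁅C, (⊤ : Subgroup G)⁆
  set π := QuotientGroup.mk' K
  have hcenter : C.map π ≤ center (G ⧸ K) := map_mk'_le_center_iff.2 le_sup_right
  have : IsMulCommutative (C.map π) :=
    le_centralizer_iff_isMulCommutative.1 (hcenter.trans (center_le_centralizer _))
  have hK : K.map π = ⊥ := (Subgroup.map_eq_bot_iff K).2 (QuotientGroup.ker_mk' K).ge
  have hbot : C.map π = ⊥ := eq_bot_of_le_powerSubgroup (hG.to_quotient K) <|
    calc C.map π ≤ (K ⊔ powerSubgroup C p).map π := map_mono h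
      _ = powerSubgroup (C.map π) p := by
        rw [Subgroup.map_sup, hK, bot_sup_eq, map_powerSubgroup]
  rwa [Subgroup.map_eq_bot_iff, QuotientGroup.ker_mk'] at hbot

/-- To show `[N ^ p, G] ≤ (N ^ p) ^ p` one may, by the Frattini argument of
`le_of_le_sup_commutator_sup_powerSubgroup`, assume that `[N ^ p, G]` is central of exponent `p`. -/
theorem isPowerfullyEmbedded_powerSubgroup [Finite G] [Fact p.Prime] (hG : IsPGroup p G)
    {N : Subgroup G} [N.Normal] (hN : IsPowerfullyEmbedded p N) :
    IsPowerfullyEmbedded p (powerSubgroup N p) := by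
  set M := powerSubgroup N p
  set C := ⁅M, (⊤ : Subgroup G)⁆
  refine le_of_le_sup_commutator_sup_powerSubgroup hG ?_
  set K := powerSubgroup M (powerfulExponent p) ⊔ ⁅C, (⊤ : Subgroup G)⁆ ⊔
    powerSubgroup C p
  set π := QuotientGroup.mk' K
  have hπ : Function.Surjective π := QuotientGroup.mk'_surjective K
  have hπM : powerSubgroup (N.map π) p = M.map π :=
    (map_powerSubgroup π N p).symm
  have hπC : ⁅M.map π, (⊤ : Subgroup (G ⧸ K))⁆ = C.map π := by
    rw [← map_top_of_surjective π hπ, ← map_commutator]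
  rw [← map_mk'_le_center_iff, ← hπM]
  refine (hN.map hπ).powerSubgroup_le_center ?_ ?_ ?_
  · rw [hπM]
    rintro _ ⟨m, hm, rfl⟩
    rw [← map_pow]
    exact (QuotientGroup.eq_one_iff _).2
      (mem_sup_left (mem_sup_left (pow_mem_powerSubgroup hm _)))
  · rw [hπM, hπC, map_mk'_le_center_iff]
    exact le_sup_right.trans le_sup_left
  · rw [hπM, hπC]
    rintro _ ⟨c, hc, rfl⟩
    rw [← map_pow]
    exact (QuotientGroup.eq_one_iff _).2 (mem_sup_right (pow_mem_powerSubgroup hc _))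

end FinitePGroup

section IteratedPowerSubgroup

variable {G : Type*} [Group G] (p : ℕ)

/-- The iterated power subgroup `(⋯((G ^ p) ^ p)⋯) ^ p`. -/
def iteratedPowerSubgroup (G : Type*) [Group G] (p : ℕ) : ℕ → Subgroup G
  | 0 => ⊤
  | i + 1 => powerSubgroup (iteratedPowerSubgroup G p i) p

instance iteratedPowerSubgroup_normal (i : ℕ) : (iteratedPowerSubgroup G p i).Normal := by
  induction i with
  | zero => rw [iteratedPowerSubgroup]; infer_instance
  | succ i ih => rw [iteratedPowerSubgroup]; infer_instance

theorem map_iteratedPowerSubgroup {H : Type*} [Group H] {f : G →* H} (hf : Function.Surjective f)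
    (i : ℕ) : (iteratedPowerSubgroup G p i).map f = iteratedPowerSubgroup H p i := by
  induction i with
  | zero => exact map_top_of_surjective f hf
  | succ i ih => rw [iteratedPowerSubgroup, map_powerSubgroup, ih, iteratedPowerSubgroup]

theorem pow_mem_iteratedPowerSubgroup (x : G) (i : ℕ) :
    x ^ p ^ i ∈ iteratedPowerSubgroup G p i := by
  induction i with
  | zero => trivial
  | succ i ih => rw [pow_succ, pow_mul]; exact pow_mem_powerSubgroup ih p

variable {p} [Finite G] [Fact p.Prime] (hG : IsPGroup p G)
include hG

theorem isPowerfullyEmbedded_iteratedPowerSubgroup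
    (h : IsPowerfullyEmbedded p (⊤ : Subgroup G)) (i : ℕ) :
    IsPowerfullyEmbedded p (iteratedPowerSubgroup G p i) := by
  induction i with
  | zero => exact h
  | succ i ih => exact isPowerfullyEmbedded_powerSubgroup hG ih

theorem exists_iteratedPowerSubgroup_eq_bot : ∃ i, iteratedPowerSubgroup G p i = ⊥ := by
  by_contra! hne
  refine not_injective_infinite_finite _ (strictAnti_nat_of_succ_lt
    (f := iteratedPowerSubgroup G p) fun i => ?_).injective
  refine lt_of_le_not_ge (powerSubgroup_le_self _ p) fun hle => hne i (le_bot_iff.1 ?_)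
  exact le_of_le_sup_commutator_sup_powerSubgroup hG (hle.trans le_sup_right)

end IteratedPowerSubgroup

/-! ### Minkowski's lemma -/

section Minkowski

variable {R : Type*} [Ring R] {p : ℕ}

theorem sq_dvd_pow_sub_one_sub_natCast_mul {x : R} (hx : (p : R) ∣ x - 1) (k : ℕ) :
    (p : R) ^ 2 ∣ x ^ k - 1 - k * (x - 1) := by
  have hsq : (p : R) ^ 2 ∣ (x - 1) * (x - 1) := by
    obtain ⟨y, hy⟩ := hx
    refine ⟨y * y, ?_⟩
    rw [hy, sq]
    simp only [mul_assoc, (Nat.cast_commute p y).left_comm]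
  induction k with
  | zero => simp
  | succ k ih =>
    have hstep : x ^ (k + 1) - 1 - (k + 1 : ℕ) * (x - 1) =
        (x ^ k - 1 - k * (x - 1)) * x + (x - 1) * (x - 1) * k := by
      rw [(Nat.cast_commute k _).symm.eq, pow_succ]
      push_cast
      noncomm_ring
    rw [hstep]
    exact dvd_add (ih.mul_right x) (hsq.mul_right _)

theorem sq_dvd_geom_sum_sub [Fact p.Prime] {x : R} (hx : (powerfulExponent p : R) ∣ x - 1) :
    (p : R) ^ 2 ∣ ∑ i ∈ Finset.range p, x ^ i - p := by
  have hp : (p : R) ∣ x - 1 := (Nat.cast_dvd_cast (dvd_powerfulExponent p)).trans hx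
  have hchoose : (p : R) ^ 2 ∣ (p.choose 2 : R) * (x - 1) := by
    obtain rfl | hp2 := eq_or_ne p 2
    · simpa [powerfulExponent, show (2 : R) ^ 2 = 4 by norm_num] using hx
    · obtain ⟨c, hc⟩ := (Fact.out : p.Prime).dvd_choose_self two_ne_zero
        (lt_of_le_of_ne (Fact.out : p.Prime).two_le hp2.symm)
      obtain ⟨y, hy⟩ := hp
      refine ⟨c * y, ?_⟩
      rw [hc, hy, sq, Nat.cast_mul]
      simp only [mul_assoc, (Nat.cast_commute p (c : R)).left_comm]
  have hsum : ∑ i ∈ Finset.range p, x ^ i - p =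
      ∑ i ∈ Finset.range p, (x ^ i - 1 - i * (x - 1)) + p.choose 2 * (x - 1) := by
    rw [Finset.sum_sub_distrib, Finset.sum_sub_distrib, ← Finset.sum_mul, ← Nat.cast_sum,
      Finset.sum_range_id, Nat.choose_two_right]
    simp
  rw [hsum]
  exact dvd_add (Finset.dvd_sum fun i _ => sq_dvd_pow_sub_one_sub_natCast_mul hp i) hchoose

theorem eq_one_of_pow_prime_pow_eq_one [IsAddTorsionFree R] [hp : Fact p.Prime]
    (hsep : ∀ z : R, (∀ n, (p : R) ^ n ∣ z) → z = 0) {x : R}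
    (hx : (powerfulExponent p : R) ∣ x - 1) {k : ℕ} (hk : x ^ p ^ k = 1) : x = 1 := by
  induction k generalizing x with
  | zero => simpa using hk
  | succ k ih =>
    rw [pow_succ', pow_mul] at hk
    have hxp : x ^ p = 1 := ih (by rw [← mul_geom_sum]; exact hx.mul_right _) hk
    obtain ⟨t, ht⟩ := sq_dvd_geom_sum_sub hx
    have hdiv : (x - 1) * (p * (-t)) = x - 1 := by
      have hzero : p • ((x - 1) * (p * t) + (x - 1)) = 0 := by
        have := mul_geom_sum x p
        rw [hxp, sub_self, sub_eq_iff_eq_add.1 ht] at this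
        rw [← this, nsmul_eq_mul, sq, mul_add, mul_add, mul_assoc,
          (Nat.cast_commute p (x - 1)).left_comm, (Nat.cast_commute p (x - 1)).eq]
      have := (smul_eq_zero.1 hzero).resolve_left hp.out.ne_zero
      rw [mul_neg, mul_neg, neg_eq_iff_add_eq_zero, this]
    refine sub_eq_zero.1 (hsep _ fun n => ⟨(x - 1) * (-t) ^ n, ?_⟩)
    induction n with
    | zero => simp
    | succ n ihn =>
      calc x - 1 = (x - 1) * (p * (-t)) := hdiv.symm
        _ = p ^ n * ((x - 1) * (-t) ^ n) * (p * (-t)) := by rw [← ihn]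
        _ = p ^ (n + 1) * ((x - 1) * (-t) ^ (n + 1)) := by
          rw [pow_succ (p : R), pow_succ (-t)]
          simp only [mul_assoc, (Nat.cast_commute p (x - 1)).left_comm,
            (Nat.cast_commute p ((-t) ^ n)).left_comm]

end Minkowski

theorem linearMap_eq_one_of_pow_prime_pow_eq_one {E : Type*} [AddCommGroup E] [Module.Finite ℤ E]
    [IsAddTorsionFree E] {p : ℕ} [hp : Fact p.Prime] {f : Module.End ℤ E}
    (hf : ∀ v, ∃ w, f v - v = powerfulExponent p • w) {k : ℕ} (hk : f ^ p ^ k = 1) : f = 1 := by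
  have hq : powerfulExponent p ≠ 0 := fun h =>
    pow_ne_zero 2 hp.out.ne_zero (zero_dvd_iff.1 (h ▸ powerfulExponent_dvd_sq p))
  have : IsAddTorsionFree (Module.End ℤ E) :=
    ⟨fun _ hn _ _ h => LinearMap.ext fun v => nsmul_right_injective hn (LinearMap.congr_fun h v)⟩
  refine eq_one_of_pow_prime_pow_eq_one (fun z hz => LinearMap.ext fun v => ?_) ?_ hk
  · have hbot := Ideal.iInf_pow_smul_eq_bot_of_isTorsionFree (M := E) (Ideal.span {(p : ℤ)})
      (by simpa [Ideal.span_singleton_eq_top, Int.isUnit_iff_natAbs_eq] using hp.out.ne_one)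
    rw [LinearMap.zero_apply, ← Submodule.mem_bot ℤ, ← hbot, Submodule.mem_iInf]
    intro n
    obtain ⟨s, rfl⟩ := hz n
    rw [Ideal.span_singleton_pow, Submodule.ideal_span_singleton_smul, ← Nat.cast_pow,
      ← Nat.cast_pow, Module.End.mul_apply, Module.End.natCast_apply, ← natCast_zsmul]
    exact Submodule.smul_mem_pointwise_smul _ _ _ trivial
  · choose w hw using hf
    refine ⟨(AddMonoidHom.mk' w fun u v => nsmul_right_injective hq ?_).toIntLinearMap,
      LinearMap.ext fun v => ?_⟩
    · simp only [smul_add, ← hw, map_add]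
      abel
    · simpa [Module.End.natCast_apply] using hw v

/-! ### Rational characters of `p`-powerful groups -/

theorem isPGroup_quotient_iff {G : Type*} [Group G] {p : ℕ} {N : Subgroup G} [N.Normal] :
    IsPGroup p (G ⧸ N) ↔ ∀ g : G, ∃ k, g ^ p ^ k ∈ N := by
  simp only [IsPGroup, QuotientGroup.mk_surjective.forall, ← QuotientGroup.mk_pow,
    QuotientGroup.eq_one_iff]

theorem IsPPowerful.of_surjective {p : ℕ} {G H : Type} [Group G] [Group H] (hG : IsPPowerful p G)
    {f : G →* H} (hf : Function.Surjective f) : IsPPowerful p H := by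
  intro N _ hfin hN
  let e : G ⧸ N.comap f ≃* H ⧸ N :=
    QuotientGroup.liftEquiv (N.comap f) (φ := (QuotientGroup.mk' N).comp f)
      ((QuotientGroup.mk'_surjective N).comp hf)
      (by rw [← MonoidHom.comap_ker, QuotientGroup.ker_mk'])
  have h := hG (N.comap f) (Finite.of_equiv _ e.symm.toEquiv) (hN.of_equiv e.symm)
  rw [isPowerful_iff_isPowerfullyEmbedded_top] at h ⊢
  have he : Function.Surjective e.toMonoidHom := e.surjective
  simpa only [map_top_of_surjective _ he] using h.map he

theorem finiteIndex_of_commutator_le {G : Type*} [Group G] {N M : Subgroup G} [Group.FG N]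
    [N.FiniteIndex] (hcomm : ⁅N, N⁆ ≤ M) {m : ℕ} (hm : m ≠ 0) (hpow : powerSubgroup N m ≤ M) :
    M.FiniteIndex := by
  have hcomm' : commutator N ≤ M.subgroupOf N :=
    map_le_iff_le_comap.1 (map_subtype_commutator N ▸ hcomm)
  have hnormal : (M.subgroupOf N).Normal := Normal.of_commutator_le _ hcomm'
  have hquot := Normal.quotient_commutative_iff_commutator_le.2 hcomm'
  have hfin : Finite (N ⧸ M.subgroupOf N) :=
    CommGroup.finite_of_fg_isMulTorsion _ <| QuotientGroup.mk_surjective.forall.2 fun a =>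
      isOfFinOrder_iff_pow_eq_one.2 ⟨m, Nat.pos_of_ne_zero hm,
        (QuotientGroup.eq_one_iff _).2 (hpow (pow_mem_powerSubgroup a.2 m))⟩
  have hrel : M.relIndex N ≠ 0 := Subgroup.index_ne_zero_of_finite
  have hindex : N.relIndex ⊤ ≠ 0 := N.relIndex_top_right ▸ FiniteIndex.index_ne_zero
  exact ⟨M.relIndex_top_right ▸ relIndex_ne_zero_trans hrel hindex⟩

section CommutativeSubgroup

variable {G : Type*} [Group G] {A : Subgroup G} [IsMulCommutative A] [Group.FG A]

theorem finiteIndex_powerSubgroup [A.FiniteIndex] {m : ℕ} (hm : m ≠ 0) :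
    (powerSubgroup A m).FiniteIndex :=
  finiteIndex_of_commutator_le (commutator_self_eq_bot_iff.2 ‹_› |>.trans_le bot_le) hm le_rfl

/-- By Minkowski's lemma: conjugation by `g` has finite `p`-power order on `A` and is trivial
modulo `p`-th (or fourth) powers. -/
theorem IsPowerfullyEmbedded.commute_of_pow_mem [IsMulTorsionFree A] [A.Normal] {p : ℕ}
    [Fact p.Prime] (hA : IsPowerfullyEmbedded p A) {g : G} {k : ℕ} (hg : g ^ p ^ k ∈ A) {a : G}
    (ha : a ∈ A) : Commute g a := by
  let ρ : Representation ℤ (ConjAct G) (Additive A) := .ofMulDistribMulAction (ConjAct G) A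
  have coe_ρ (g : G) (v : Additive A) :
      ((ρ (ConjAct.toConjAct g) v).toMul : G) = g * v.toMul * g⁻¹ := rfl
  have hone : ρ (ConjAct.toConjAct g) = 1 := by
    refine linearMap_eq_one_of_pow_prime_pow_eq_one (p := p) (k := k) (fun v => ?_) ?_
    · have hmem : ⁅g, (v.toMul : G)⁆ ∈ ⁅A, (⊤ : Subgroup G)⁆ := by
        rw [commutator_comm]
        exact commutator_mem_commutator (mem_top g) v.toMul.2
      obtain ⟨b, hb, hbv⟩ := exists_pow_eq_of_mem_powerSubgroup (hA hmem)
      refine ⟨Additive.ofMul ⟨b, hb⟩, Additive.toMul.injective (Subtype.ext ?_)⟩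
      change ((ρ (ConjAct.toConjAct g) v).toMul : G) / v.toMul = b ^ powerfulExponent p
      rw [coe_ρ, hbv, div_eq_mul_inv, commutatorElement_def]
    · rw [← map_pow, ← map_pow]
      refine LinearMap.ext fun v => Additive.toMul.injective (Subtype.ext ?_)
      rw [coe_ρ, setLike_mul_comm hg v.toMul.2, mul_inv_cancel_right, Module.End.one_apply]
  have hconj : g * a * g⁻¹ = a := by
    have := coe_ρ g (Additive.ofMul ⟨a, ha⟩)
    rw [hone] at this
    exact this.symm
  exact mul_inv_eq_iff_eq_mul.1 hconj

end CommutativeSubgroup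

/-- By transfer: a character of a central subgroup of finite index extends, up to a power, to the
whole group. -/
theorem eq_one_of_mem_center_of_subsingleton {G : Type*} [Group G]
    [Subsingleton (G →* Multiplicative ℚ)] {U : Subgroup G} [U.FiniteIndex] (hU : U ≤ center G)
    (χ : U →* Multiplicative ℚ) (u : U) : χ u = 1 := by
  have htransfer : χ.transfer (u : G) = χ u ^ U.index := by
    rw [MonoidHom.transfer_eq_pow _ _ fun k g₀ _ => ?_, ← map_pow]
    · rfl
    · rw [mul_assoc, (mem_center_iff.1 (pow_mem (hU u.2) k) g₀).symm, inv_mul_cancel_left]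
  rw [Subsingleton.elim χ.transfer 1, MonoidHom.one_apply] at htransfer
  exact (pow_eq_one_iff_left FiniteIndex.index_ne_zero).1 htransfer.symm

section IsPPowerful

variable {G : Type} [Group G] {p : ℕ} [hp : Fact p.Prime]

theorem IsPPowerful.iteratedPowerSubgroup_le_center (hG : IsPPowerful p G) {i : ℕ}
    [IsMulCommutative (iteratedPowerSubgroup G p i)]
    [IsMulTorsionFree (iteratedPowerSubgroup G p i)] [Group.FG (iteratedPowerSubgroup G p i)]
    [(iteratedPowerSubgroup G p i).FiniteIndex] : iteratedPowerSubgroup G p i ≤ center G := by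
  set A := iteratedPowerSubgroup G p i
  set B := powerSubgroup A (p ^ 2)
  have hBA : B ≤ powerSubgroup A (powerfulExponent p) := powerSubgroup_le_iff.2 fun a ha => by
    obtain ⟨c, hc⟩ := powerfulExponent_dvd_sq p
    rw [hc, mul_comm, pow_mul]
    exact pow_mem_powerSubgroup (A.pow_mem ha c) _
  have : B.FiniteIndex := finiteIndex_powerSubgroup (pow_ne_zero 2 hp.out.ne_zero)
  have hGB : IsPGroup p (G ⧸ B) := isPGroup_quotient_iff.2 fun g => ⟨i + 2, by
    rw [pow_add, pow_mul]
    exact pow_mem_powerSubgroup (pow_mem_iteratedPowerSubgroup p g i) _⟩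
  have hπ := QuotientGroup.mk'_surjective B
  have hquot : IsPowerfullyEmbedded p (A.map (QuotientGroup.mk' B)) := by
    rw [map_iteratedPowerSubgroup p hπ]
    exact isPowerfullyEmbedded_iteratedPowerSubgroup hGB
      (isPowerful_iff_isPowerfullyEmbedded_top.1 (hG B inferInstance hGB)) i
  have hA : IsPowerfullyEmbedded p A := by
    rwa [IsPowerfullyEmbedded, ← map_powerSubgroup, ← map_top_of_surjective _ hπ,
      ← map_commutator, map_le_iff_le_comap, QuotientGroup.comap_map_mk',
      sup_eq_right.2 hBA] at hquot
  exact fun a ha => mem_center_iff.2 fun g =>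
    hA.commute_of_pow_mem (pow_mem_iteratedPowerSubgroup p g i) ha

theorem IsPPowerful.subsingleton_of_isMulTorsionFree (hG : IsPPowerful p G) [Group.FG G]
    [Subsingleton (G →* Multiplicative ℚ)] {A : Subgroup G} [A.Normal] [A.FiniteIndex]
    [IsMulCommutative A] [IsMulTorsionFree A] (hA : IsPGroup p (G ⧸ A)) :
    Subsingleton (A →* Multiplicative ℚ) := by
  obtain ⟨i, hi⟩ := exists_iteratedPowerSubgroup_eq_bot hA
  set U := iteratedPowerSubgroup G p i
  have hUA : U ≤ A := by
    rwa [← map_iteratedPowerSubgroup p (QuotientGroup.mk'_surjective A),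
      Subgroup.map_eq_bot_iff, QuotientGroup.ker_mk'] at hi
  have : IsMulCommutative U :=
    .of_setLike_mul_comm fun _ ha _ hb => setLike_mul_comm (hUA ha) (hUA hb)
  have : IsMulTorsionFree U := (inclusion_injective hUA).isMulTorsionFree
  have : Group.FG A := fg_of_index_ne_zero A
  have : (powerSubgroup A (p ^ i)).FiniteIndex :=
    finiteIndex_powerSubgroup (pow_ne_zero i hp.out.ne_zero)
  have : U.FiniteIndex := finiteIndex_of_le (H := powerSubgroup A (p ^ i))
    (powerSubgroup_le_iff.2 fun a _ => pow_mem_iteratedPowerSubgroup p a i)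
  have : Group.FG U := fg_of_index_ne_zero U
  refine subsingleton_of_forall_eq 1 fun χ => MonoidHom.ext fun a => ?_
  have hpow : χ a ^ p ^ i = 1 := by
    rw [← map_pow]
    exact eq_one_of_mem_center_of_subsingleton hG.iteratedPowerSubgroup_le_center
      (χ.comp (inclusion hUA)) ⟨_, pow_mem_iteratedPowerSubgroup p (a : G) i⟩
  exact (pow_eq_one_iff_left (pow_ne_zero i hp.out.ne_zero)).1 hpow

end IsPPowerful

section RationalRadical

/-- The intersection of the kernels of all homomorphisms `G →* ℚ`, as the kernel of the homomorphism
evaluating all of them at once. The quotient by it is the largest torsion-free abelian quotient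
of `G` if `G` is finitely generated. -/
def rationalRadical (G : Type*) [Group G] : Subgroup G :=
  (MonoidHom.pi fun χ : G →* Multiplicative ℚ => χ).ker

variable {G H : Type*} [Group G] [Group H]

theorem mem_rationalRadical_iff {x : G} :
    x ∈ rationalRadical G ↔ ∀ χ : G →* Multiplicative ℚ, χ x = 1 :=
  funext_iff

instance : (rationalRadical G).Characteristic :=
  characteristic_iff_le_comap.2 fun e _ hx => mem_rationalRadical_iff.2 fun χ =>
    mem_rationalRadical_iff.1 hx (χ.comp e.toMonoidHom)

variable {f : G →* H} (hf : Function.Surjective f) (hker : f.ker = rationalRadical G)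
include hf hker

theorem exists_injective_of_ker_eq_rationalRadical :
    ∃ j : H →* ((G →* Multiplicative ℚ) → Multiplicative ℚ), Function.Injective j := by
  refine ⟨f.liftOfSurjective hf ⟨MonoidHom.pi fun χ => χ, hker.le⟩,
    (injective_iff_map_eq_one _).2 (hf.forall.2 fun x hx => ?_)⟩
  rw [MonoidHom.liftOfRightInverse_comp_apply] at hx
  exact hker.ge hx

theorem isMulCommutative_of_ker_eq_rationalRadical : IsMulCommutative H := by
  obtain ⟨j, hj⟩ := exists_injective_of_ker_eq_rationalRadical hf hker
  exact .of_comm fun a b => hj (by rw [map_mul, map_mul, mul_comm])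

theorem isMulTorsionFree_of_ker_eq_rationalRadical : IsMulTorsionFree H := by
  obtain ⟨j, hj⟩ := exists_injective_of_ker_eq_rationalRadical hf hker
  exact hj.isMulTorsionFree

theorem subsingleton_of_ker_eq_rationalRadical [Subsingleton (H →* Multiplicative ℚ)] :
    Subsingleton (G →* Multiplicative ℚ) := by
  refine subsingleton_of_forall_eq 1 fun χ => ?_
  have hle : f.ker ≤ χ.ker := fun x hx => mem_rationalRadical_iff.1 (hker.le hx) χ
  calc χ = (f.liftOfSurjective hf ⟨χ, hle⟩).comp f :=
        (f.liftOfRightInverse_comp _ (Function.rightInverse_surjInv hf) ⟨χ, hle⟩).symm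
    _ = 1 := by rw [Subsingleton.elim (f.liftOfSurjective hf ⟨χ, hle⟩) 1, MonoidHom.one_comp]

end RationalRadical

theorem IsPPowerful.subsingleton_rationalCharacter {G : Type} [Group G] [Group.FG G] {p : ℕ}
    [Fact p.Prime] (hG : IsPPowerful p G) [Subsingleton (G →* Multiplicative ℚ)] {N : Subgroup G}
    [N.Normal] [N.FiniteIndex] (hN : IsPGroup p (G ⧸ N)) :
    Subsingleton (N →* Multiplicative ℚ) := by
  set T := (rationalRadical N).map N.subtype
  set π := QuotientGroup.mk' T
  have hπ : Function.Surjective π := QuotientGroup.mk'_surjective T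
  have hρ : Function.Surjective (π.subgroupMap N) := π.subgroupMap_surjective N
  have hker : (π.subgroupMap N).ker = rationalRadical N := by
    rw [ker_subgroupMap, QuotientGroup.ker_mk']
    exact comap_map_eq_self_of_injective N.subtype_injective _
  have := isMulCommutative_of_ker_eq_rationalRadical hρ hker
  have := isMulTorsionFree_of_ker_eq_rationalRadical hρ hker
  have : (N.map π).Normal := Normal.map inferInstance π hπ
  have : (N.map π).FiniteIndex := ⟨ne_zero_of_dvd_ne_zero FiniteIndex.index_ne_zero
    (index_map_dvd N hπ)⟩
  have : Subsingleton ((G ⧸ T) →* Multiplicative ℚ) :=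
    ⟨fun f g => (MonoidHom.cancel_right hπ).1 (Subsingleton.elim _ _)⟩
  have hquot : IsPGroup p ((G ⧸ T) ⧸ N.map π) := isPGroup_quotient_iff.2 <| hπ.forall.2 fun g =>
    (isPGroup_quotient_iff.1 hN g).imp fun k hk => by
      rw [← map_pow]
      exact mem_map_of_mem π hk
  have := (hG.of_surjective hπ).subsingleton_of_isMulTorsionFree hquot
  exact subsingleton_of_ker_eq_rationalRadical hρ hker

/-! ### Multiplicative quadratic norms and valuations -/

section Hensel

open Filter

theorem exists_sq_add_eq_self {L Γ₀ : Type*} [Field L] [LinearOrderedCommGroupWithZero Γ₀]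
    [MulArchimedean Γ₀] [Valued L Γ₀] [CompleteSpace L] {c : L} (hc : Valued.v c < 1) :
    ∃ y : L, y ^ 2 + c = y := by
  let f : L → L := fun y => y ^ 2 + c
  have hf_le (n : ℕ) : Valued.v (f^[n] 0) ≤ Valued.v c := by
    induction n with
    | zero => simp
    | succ n ih =>
      rw [Function.iterate_succ_apply']
      refine (Valued.v.map_add _ _).trans (max_le ?_ le_rfl)
      rw [map_pow]
      exact (pow_le_of_le_one zero_le (ih.trans hc.le) two_ne_zero).trans ih
  have hf_sub (n : ℕ) : Valued.v (f^[n + 1] 0 - f^[n] 0) ≤ Valued.v (c ^ n) := by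
    induction n with
    | zero => simpa [f] using hc.le
    | succ n ih =>
      have hfactor : f^[n + 1 + 1] 0 - f^[n + 1] 0 =
          (f^[n + 1] 0 - f^[n] 0) * (f^[n + 1] 0 + f^[n] 0) := by
        rw [Function.iterate_succ_apply' f (n + 1), Function.iterate_succ_apply' f n]
        ring
      rw [hfactor, map_mul, pow_succ, map_mul]
      exact mul_le_mul' ih ((Valued.v.map_add _ _).trans (max_le (hf_le _) (hf_le _)))
  have : NonarchimedeanRing L :=
    (Valued.toUniformSpace_eq L Γ₀).symm ▸ Valued.v.subgroups_basis.nonarchimedean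
  have hcauchy : CauchySeq fun n => f^[n] 0 := by
    refine NonarchimedeanAddGroup.cauchySeq_of_tendsto_sub_nhds_zero ?_
    refine ((Valued.hasBasis_nhds_zero L Γ₀).tendsto_right_iff).2 fun γ _ => ?_
    filter_upwards [((Valued.hasBasis_nhds_zero L Γ₀).tendsto_right_iff).1
      (Valued.tendsto_zero_pow_of_v_lt_one hc) γ trivial] with n hn
    exact (Valued.v.restrict_le_iff.2 (hf_sub n)).trans_lt hn
  obtain ⟨y, hy⟩ := cauchySeq_tendsto_of_complete hcauchy
  exact ⟨y, isFixedPt_of_tendsto_iterate hy (by fun_prop)⟩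

end Hensel

section DiscreteValuation

variable {K : Type*} [Field K] (V : ValuationSubring K)

theorem mulArchimedean_valueGroup [IsNoetherianRing V] : MulArchimedean V.ValueGroup where
  arch x y hy := by
    by_contra! hlt
    obtain ⟨a, rfl⟩ := V.valuation_surjective x
    obtain ⟨b, rfl⟩ := V.valuation_surjective y
    have hb : V.valuation b⁻¹ < 1 := by rw [map_inv₀]; exact inv_lt_one_of_one_lt₀ hy
    have ha (n : ℕ) : V.valuation a⁻¹ ≤ V.valuation (b⁻¹ ^ n) := by
      simp only [map_inv₀, map_pow, inv_pow]
      exact inv_anti₀ (pow_pos (zero_lt_one.trans hy) n) (hlt n).le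
    let a' : V := ⟨a⁻¹, V.mem_of_valuation_le_one _ (by simpa using ha 0)⟩
    let b' : V := ⟨b⁻¹, V.mem_of_valuation_le_one _ hb.le⟩
    have hspan : Ideal.span {b'} ≠ ⊤ := fun h =>
      (V.valuation_lt_one_iff b').2 hb (Ideal.span_singleton_eq_top.1 h)
    have ha' : a' ∈ ⨅ n : ℕ, Ideal.span {b'} ^ n := by
      refine Submodule.mem_iInf _ |>.2 fun n => ?_
      obtain ⟨d, hd⟩ := (V.valuation_le_iff _ _).1 (ha n)
      rw [Ideal.span_singleton_pow, Ideal.mem_span_singleton]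
      exact ⟨d, Subtype.ext (by simpa [a', b', mul_comm] using hd.symm)⟩
    rw [Ideal.iInf_pow_eq_bot_of_isLocalRing _ hspan] at ha'
    have ha0 : a = 0 := by simpa [a', Subtype.ext_iff] using ha'
    exact absurd (hlt 0) (by simp [ha0])

end DiscreteValuation

open QuadraticMap in
/-- A reduced norm on a `K`-algebra: a multiplicative quadratic form `N` for which every element is
a root of its characteristic polynomial `X ^ 2 - N(x, 1) X + N(x)`, where `N(x, y)` is the polar
form. The determinant of `2 × 2` matrices is the model; here it serves to turn valuations of `K`
into valuations of `A`. -/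
structure ReducedNorm (K A : Type*) [Field K] [Ring A] [Algebra K A] where
  norm : QuadraticForm K A
  norm_one : norm 1 = 1
  norm_mul : ∀ x y, norm (x * y) = norm x * norm y
  sq_eq : ∀ x, x ^ 2 = polar norm x 1 • x - norm x • 1

open scoped TensorProduct in
theorem exists_eq_smul_one_of_one_tmul_eq {K L A : Type*} [Field K] [CommRing L] [Nontrivial L]
    [Algebra K L] [Ring A] [Algebra K A] {z : A} {w : L}
    (h : (1 : L) ⊗ₜ[K] z = w ⊗ₜ[K] (1 : A)) : ∃ a : K, z = a • 1 := by
  suffices z ∈ Submodule.span K {(1 : A)} by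
    obtain ⟨a, ha⟩ := Submodule.mem_span_singleton.1 this
    exact ⟨a, ha.symm⟩
  by_contra hz
  obtain ⟨f, hf, hf1⟩ := Submodule.exists_le_ker_of_notMem hz
  have hf1' : f 1 = 0 := hf1 (Submodule.mem_span_singleton_self 1)
  have hfz := congrArg (fun x => TensorProduct.rid K L (LinearMap.lTensor L f x)) h
  simp only [LinearMap.lTensor_tmul, TensorProduct.rid_tmul, hf1', zero_smul,
    ← Algebra.algebraMap_eq_smul_one, map_eq_zero_iff _ (algebraMap K L).injective] at hfz
  exact hf hfz

namespace ReducedNorm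

open scoped TensorProduct

variable {K A : Type*} [Field K] [Ring A] [Algebra K A] (ν : ReducedNorm K A)

/-- The reduced trace, the linear coefficient of the characteristic polynomial. -/
def trace (x : A) : K := QuadraticMap.polar ν.norm x 1

/-- The canonical involution of an algebra with a reduced norm. -/
def conj (x : A) : A := ν.trace x • 1 - x

theorem norm_smul_one (a : K) : ν.norm (a • (1 : A)) = a ^ 2 := by
  rw [QuadraticMap.map_smul, ν.norm_one, smul_eq_mul, mul_one, sq]

theorem trace_smul_one (a : K) : ν.trace (a • (1 : A)) = 2 * a := by
  rw [trace, QuadraticMap.polar_smul_left, QuadraticMap.polar_self, ν.norm_one, smul_eq_mul]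
  simp [mul_comm]

theorem norm_add_one (x : A) : ν.norm (x + 1) = ν.norm x + ν.trace x + 1 := by
  rw [trace, QuadraticMap.polar, ν.norm_one]
  ring

theorem mul_conj (x : A) : x * ν.conj x = ν.norm x • 1 := by
  rw [conj, mul_sub, mul_smul_one, ← sq, ν.sq_eq, trace]
  abel

theorem norm_eq_zero_iff [NoZeroDivisors A] {x : A} : ν.norm x = 0 ↔ x = 0 := by
  refine ⟨fun hx => ?_, fun hx => by rw [hx, QuadraticMap.map_zero]⟩
  rcases mul_eq_zero.1 ((ν.mul_conj x).trans (by rw [hx, zero_smul])) with h | h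
  · exact h
  · have hscalar : x = ν.trace x • (1 : A) := (sub_eq_zero.1 h).symm
    rw [hscalar, norm_smul_one, sq_eq_zero_iff] at hx
    rw [hscalar, hx, zero_smul]

variable {L : Type*} [CommRing L] [Algebra K L]

theorem tmul_one_sub_mul_eq_zero {x : A} {y : L}
    (hy : y ^ 2 + algebraMap K L (ν.norm x) = algebraMap K L (ν.trace x) * y) :
    ((1 : L) ⊗ₜ[K] x - y ⊗ₜ[K] (1 : A)) *
      ((1 : L) ⊗ₜ[K] x - (algebraMap K L (ν.trace x) - y) ⊗ₜ[K] (1 : A)) = 0 := by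
  have hx : x * x = ν.trace x • x - ν.norm x • 1 := by rw [← sq, ν.sq_eq, trace]
  have hy' : y * y = ν.trace x • y - ν.norm x • 1 := by
    simp only [Algebra.smul_def, mul_one]
    linear_combination hy
  simp only [sub_mul, mul_sub, Algebra.TensorProduct.tmul_mul_tmul, one_mul, mul_one, hx, hy',
    TensorProduct.tmul_sub, TensorProduct.tmul_smul, ← TensorProduct.smul_tmul', mul_smul_comm,
    smul_sub, TensorProduct.sub_tmul, Algebra.algebraMap_eq_smul_one]
  abel

theorem exists_eq_smul_one_of_root [Nontrivial L] [NoZeroDivisors (L ⊗[K] A)] {x : A} {y : L}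
    (hy : y ^ 2 + algebraMap K L (ν.norm x) = algebraMap K L (ν.trace x) * y) :
    ∃ a : K, x = a • 1 := by
  rcases mul_eq_zero.1 (ν.tmul_one_sub_mul_eq_zero hy) with h | h <;>
    exact exists_eq_smul_one_of_one_tmul_eq (sub_eq_zero.1 h)

variable {Γ₀ : Type*} [LinearOrderedCommGroupWithZero Γ₀]

/-- If `v(N x) < v(Tr x)²`, the characteristic polynomial of `x` splits over the completion by
Hensel's lemma, which forces `x` to be a scalar in `K` and then `Tr(x)² = 4 N(x)`. -/
theorem valuation_trace_sq_le {L : Type*} [Field L] [Algebra K L] [MulArchimedean Γ₀] [Valued L Γ₀]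
    [CompleteSpace L] [NoZeroDivisors (L ⊗[K] A)] {v : Valuation K Γ₀}
    (hv : ∀ a, Valued.v (algebraMap K L a) = v a) (x : A) :
    v (ν.trace x) ^ 2 ≤ v (ν.norm x) := by
  by_contra! hlt
  have ht : ν.trace x ≠ 0 := by
    rintro h
    simp [h] at hlt
  obtain ⟨y, hy⟩ : ∃ y : L, y ^ 2 + algebraMap K L (ν.norm x / ν.trace x ^ 2) = y := by
    refine exists_sq_add_eq_self ?_
    rwa [hv, map_div₀, map_pow, div_lt_one₀ (pow_pos (by simpa [zero_lt_iff] using ht) 2)]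
  have hroot : (algebraMap K L (ν.trace x) * y) ^ 2 + algebraMap K L (ν.norm x) =
      algebraMap K L (ν.trace x) * (algebraMap K L (ν.trace x) * y) := by
    have ht' : algebraMap K L (ν.trace x) ≠ 0 := by simpa using ht
    rw [map_div₀, map_pow] at hy
    field_simp at hy
    linear_combination hy
  obtain ⟨a, rfl⟩ := ν.exists_eq_smul_one_of_root hroot
  have h4 : v 4 ≤ 1 := natCast_mem v.integer 4
  rw [trace_smul_one, norm_smul_one, ← map_pow, mul_pow, map_mul] at hlt
  norm_num1 at hlt
  exact hlt.not_ge (mul_le_of_le_one_left' h4)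

section Valuation

variable {v : Valuation K Γ₀} (hv : ∀ x, v (ν.trace x) ^ 2 ≤ v (ν.norm x))

include hv in
theorem valuation_norm_add_one_le (x : A) : v (ν.norm (x + 1)) ≤ max (v (ν.norm x)) 1 := by
  have htrace : v (ν.trace x) ≤ max (v (ν.norm x)) 1 := by
    by_contra! hlt
    have hlt := max_lt_iff.1 hlt
    exact ((hv x).trans_lt hlt.1).not_ge (le_self_pow hlt.2.le two_ne_zero)
  rw [norm_add_one]
  exact (v.map_add _ _).trans (max_le ((v.map_add _ _).trans (max_le (le_max_left _ _) htrace))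
    (by simp))

include hv in
theorem valuation_norm_add_le [NoZeroDivisors A] (x y : A) :
    v (ν.norm (x + y)) ≤ max (v (ν.norm x)) (v (ν.norm y)) := by
  rcases eq_or_ne y 0 with rfl | hy
  · simp
  have hNy : ν.norm y ≠ 0 := mt ν.norm_eq_zero_iff.1 hy
  set z := (ν.norm y)⁻¹ • (ν.conj y * x) with hz
  have hx : x = y * z := by
    rw [hz, mul_smul_comm, ← mul_assoc, mul_conj, smul_one_mul, inv_smul_smul₀ hNy]
  have hadd : x + y = y * (z + 1) := by rw [mul_add, ← hx, mul_one]
  rw [hadd, hx, ν.norm_mul, ν.norm_mul, map_mul, map_mul]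
  exact (mul_le_mul_right (ν.valuation_norm_add_one_le hv z) _).trans_eq
    (by rw [mul_max, mul_one])

/-- The valuation `x ↦ v (N x)` on an algebra with a reduced norm `N`. -/
def normValuation [NoZeroDivisors A] : Valuation A Γ₀ where
  toFun x := v (ν.norm x)
  map_zero' := by simp
  map_one' := by simp [ν.norm_one]
  map_mul' x y := by simp [ν.norm_mul]
  map_add_le_max' := ν.valuation_norm_add_le hv

theorem normValuation_eq_zero_iff [NoZeroDivisors A] {x : A} :
    ν.normValuation hv x = 0 ↔ x = 0 :=
  (map_eq_zero v).trans ν.norm_eq_zero_iff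

theorem normValuation_smul_one [NoZeroDivisors A] (a : K) :
    ν.normValuation hv (a • 1) = v a ^ 2 :=
  (congrArg v (ν.norm_smul_one a)).trans (map_pow v a 2)

theorem valuation_trace_le_one [NoZeroDivisors A] {x : A} (hx : ν.normValuation hv x ≤ 1) :
    v (ν.trace x) ≤ 1 :=
  (pow_le_one_iff two_ne_zero).1 ((hv x).trans hx)

end Valuation

end ReducedNorm

/-! ### Quadratic algebras over finite fields -/

section QuadraticAlgebra

variable {k D : Type*} [Field k] [Ring D] [Algebra k D]

theorem toSubmodule_adjoin_le {s : Set D} {S : Submodule k D} (h1 : 1 ∈ S)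
    (hmul : ∀ z ∈ s, S ≤ S.comap (LinearMap.mulLeft k z)) :
    Subalgebra.toSubmodule (Algebra.adjoin k s) ≤ S := by
  have hstable (z : D) (hz : z ∈ Algebra.adjoin k s) :
      S ≤ S.comap (LinearMap.mulLeft k z) := by
    induction hz using Algebra.adjoin_induction with
    | mem z hz => exact hmul z hz
    | algebraMap a => exact fun w hw => by simpa [← Algebra.smul_def] using S.smul_mem a hw
    | add z w _ _ hz hw => exact fun u hu => by simpa [add_mul] using S.add_mem (hz hu) (hw hu)
    | mul z w _ _ hz hw => exact fun u hu => by simpa [mul_assoc] using hz (hw hu)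
  exact fun z hz => by simpa using hstable z hz h1

theorem toSubmodule_adjoin_pair_le_span (hquad : ∀ x : D, ∃ a b : k, x ^ 2 = a • x + b • 1)
    (x y : D) :
    Subalgebra.toSubmodule (Algebra.adjoin k {x, y}) ≤ Submodule.span k {1, x, y, x * y} := by
  set S := Submodule.span k {1, x, y, x * y}
  have h1 : (1 : D) ∈ S := Submodule.subset_span (by simp)
  have hx : x ∈ S := Submodule.subset_span (by simp)
  have hy : y ∈ S := Submodule.subset_span (by simp)
  have hxy : x * y ∈ S := Submodule.subset_span (by simp)
  have hlin {z w : D} (hz : z ∈ S) (hw : w ∈ S) (a b : k) : a • z + b • w ∈ S :=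
    S.add_mem (S.smul_mem a hz) (S.smul_mem b hw)
  have hsq {z : D} (hz : z ∈ S) : z ^ 2 ∈ S := by
    obtain ⟨a, b, h⟩ := hquad z
    exact h ▸ hlin hz h1 a b
  have hyx : y * x ∈ S := by
    have : y * x = (x + y) ^ 2 - x ^ 2 - y ^ 2 - x * y := by noncomm_ring
    exact this ▸ S.sub_mem (S.sub_mem (S.sub_mem (hsq (S.add_mem hx hy)) (hsq hx)) (hsq hy)) hxy
  have hx_mul : S ≤ S.comap (LinearMap.mulLeft k x) := by
    obtain ⟨a, b, h⟩ := hquad x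
    refine Submodule.span_le.2 ?_
    rintro z (rfl | rfl | rfl | rfl) <;>
      simp only [SetLike.mem_coe, Submodule.mem_comap, LinearMap.mulLeft_apply, mul_one]
    · exact hx
    · exact sq z ▸ hsq hx
    · exact hxy
    · rw [← mul_assoc, ← sq, h, add_mul, smul_mul_assoc, smul_mul_assoc, one_mul]
      exact hlin hxy hy a b
  have hmul_y : S ≤ S.comap (LinearMap.mulRight k y) := by
    obtain ⟨a, b, h⟩ := hquad y
    refine Submodule.span_le.2 ?_
    rintro z (rfl | rfl | rfl | rfl) <;>
      simp only [SetLike.mem_coe, Submodule.mem_comap, LinearMap.mulRight_apply, one_mul]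
    · exact hy
    · exact hxy
    · exact sq z ▸ hsq hy
    · rw [mul_assoc, ← sq, h, mul_add, mul_smul_comm, mul_smul_comm, mul_one]
      exact hlin hxy hx a b
  have hy_mul : S ≤ S.comap (LinearMap.mulLeft k y) := by
    refine Submodule.span_le.2 ?_
    rintro z (rfl | rfl | rfl | rfl) <;>
      simp only [SetLike.mem_coe, Submodule.mem_comap, LinearMap.mulLeft_apply, mul_one]
    · exact hy
    · exact hyx
    · exact sq z ▸ hsq hy
    · exact mul_assoc y x y ▸ hmul_y hyx
  refine toSubmodule_adjoin_le h1 ?_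
  rintro z (rfl | rfl)
  · exact hx_mul
  · exact hy_mul

theorem mul_comm_of_sq_eq [Finite k] [IsDomain D]
    (hquad : ∀ x : D, ∃ a b : k, x ^ 2 = a • x + b • 1) (x y : D) : x * y = y * x := by
  have hfinite : Finite (Algebra.adjoin k {x, y}) := by
    have := FiniteDimensional.span_of_finite k (Set.toFinite {1, x, y, x * y})
    have : Finite (Submodule.span k {1, x, y, x * y}) := Module.finite_of_finite k
    exact Set.Finite.subset (Set.toFinite (Submodule.span k {1, x, y, x * y} : Set D))
      (toSubmodule_adjoin_pair_le_span hquad x y)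
  exact congrArg Subtype.val ((Finite.isDomain_to_isField (Algebra.adjoin k {x, y})).mul_comm
    ⟨x, Algebra.subset_adjoin (by simp)⟩ ⟨y, Algebra.subset_adjoin (by simp)⟩)

theorem pow_card_sq_of_sq_eq {F : Type*} [CommRing F] [IsDomain F] [Algebra k F] [Finite k] {x : F}
    {a b : k} (hx : x ^ 2 = a • x + b • 1) : x ^ Nat.card k ^ 2 = x := by
  have := Fintype.ofFinite k
  let σ := FiniteField.frobeniusAlgHom k F
  have hσ (y : F) : σ y = y ^ Nat.card k := by
    rw [FiniteField.frobeniusAlgHom_apply, Nat.card_eq_fintype_card]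
  have hσx : σ x ^ 2 = a • σ x + b • 1 := by
    rw [← map_pow, hx, map_add, map_smul, map_smul, map_one]
  have hroots : (σ x - x) * (σ x - (a • 1 - x)) = 0 := by
    rw [Algebra.smul_def] at *
    linear_combination hσx - hx
  have hσσ : σ (σ x) = x := by
    rcases mul_eq_zero.1 hroots with h | h
    · rw [sub_eq_zero.1 h, sub_eq_zero.1 h]
    · rw [sub_eq_zero.1 h, map_sub, map_smul, map_one, sub_eq_zero.1 h, sub_sub_cancel]
  rw [sq, pow_mul, ← hσ, ← hσ, hσσ]

/-- Modulo the sign, `ι` factors through the commutative group `Dˣ`, whose elements have order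
dividing `|k|² - 1`. -/
theorem eq_one_or_eq_neg_one_of_sq_eq [Finite k] [IsDomain D]
    (hquad : ∀ x : D, ∃ a b : k, x ^ 2 = a • x + b • 1)
    {G Q : Type*} [Group G] [Group Q] {f : G →* Q} (hf : Function.Surjective f) {ι : G →* D}
    (hker : ∀ g ∈ f.ker, ι g = 1 ∨ ι g = -1) {h : ℕ} (hcop : h.Coprime (Nat.card k ^ 2 - 1))
    (hcomm : ∀ γ : Q, γ ^ h ∈ commutator Q) (g : G) : ι g = 1 ∨ ι g = -1 := by
  let : CommRing D := { ‹Ring D› with mul_comm := mul_comm_of_sq_eq hquad }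
  let ψ : G →* Dˣ := (powMonoidHom 2).comp ι.toHomUnits
  have hψ_apply (g : G) : (ψ g : D) = ι g ^ 2 := rfl
  have hψ_ker : f.ker ≤ ψ.ker := fun g hg => by
    rw [MonoidHom.mem_ker, Units.ext_iff, hψ_apply, Units.val_one, sq_eq_one_iff]
    exact hker g hg
  let φ : Q →* Dˣ := f.liftOfSurjective hf ⟨ψ, hψ_ker⟩
  have hφ (g : G) : φ (f g) = ψ g := f.liftOfRightInverse_comp_apply _ _ ⟨ψ, hψ_ker⟩ g
  have hpow_h : ψ g ^ h = 1 := by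
    rw [← hφ, ← map_pow]
    exact Abelianization.commutator_subset_ker φ (hcomm _)
  have hpow_card : ψ g ^ (Nat.card k ^ 2 - 1) = 1 := by
    obtain ⟨a, b, hab⟩ := hquad (ψ g)
    refine mul_left_cancel (a := ψ g) ?_
    rw [← pow_succ', Nat.sub_add_cancel (pow_pos Nat.card_pos 2), mul_one, Units.ext_iff,
      Units.val_pow_eq_pow_val, pow_card_sq_of_sq_eq hab]
  have hψ_one : ψ g = 1 := by
    rw [← orderOf_eq_one_iff, ← Nat.dvd_one, ← hcop.gcd_eq_one]
    exact Nat.dvd_gcd (orderOf_dvd_of_pow_eq_one hpow_h) (orderOf_dvd_of_pow_eq_one hpow_card)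
  rwa [← sq_eq_one_iff, ← hψ_apply, Units.val_eq_one]

end QuadraticAlgebra

/-! ### The residue ring of a quaternion algebra at a ramified prime -/

section MaximalIdeal

variable {A Γ₀ : Type*} [Ring A] [LinearOrderedCommGroupWithZero Γ₀] (w : Valuation A Γ₀)

/-- The ideal of elements of positive valuation (multiplicatively, of value less than `1`) in the
ring of integers of a valuation on a possibly noncommutative ring. -/
def maximalIdeal : Ideal w.integer := w.ltIdeal 1

theorem mem_maximalIdeal {x : w.integer} : x ∈ maximalIdeal w ↔ w x < 1 := Iff.rfl

instance : (maximalIdeal w).IsTwoSided where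
  mul_mem_of_left {x} y hx := by
    rw [mem_maximalIdeal] at hx ⊢
    simpa using mul_lt_of_lt_of_le_one hx y.2

instance : (maximalIdeal w).IsPrime where
  ne_top' := (Ideal.ne_top_iff_one _).2 fun h => by simp [mem_maximalIdeal] at h
  mem_or_mem' {x y} hxy := by
    by_contra! h
    simp only [mem_maximalIdeal, not_lt] at h hxy
    have hmul : w (x * y) = 1 := by
      rw [map_mul, le_antisymm x.2 h.1, le_antisymm y.2 h.2, one_mul]
    exact hxy.ne hmul

end MaximalIdeal

noncomputable section

namespace ReducedNorm

open IsLocalRing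

variable {K A : Type*} [Field K] [Ring A] [NoZeroDivisors A] [Algebra K A] (ν : ReducedNorm K A)
  {V : ValuationSubring K} (hv : ∀ x, V.valuation (ν.trace x) ^ 2 ≤ V.valuation (ν.norm x))

/-- The inclusion of a valuation ring of the base field in the ring of integers of the norm
valuation. -/
def integerScalar : V →+* (ν.normValuation hv).integer :=
  ((algebraMap K A).comp V.subtype).codRestrict _ fun a => by
    change ν.normValuation hv (algebraMap K A a) ≤ 1
    rw [Algebra.algebraMap_eq_smul_one, normValuation_smul_one]
    exact pow_le_one₀ zero_le (V.valuation_le_one a)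

theorem integerScalar_mem_maximalIdeal {a : V} (ha : a ∈ IsLocalRing.maximalIdeal V) :
    ν.integerScalar hv a ∈ HypMfd.maximalIdeal (ν.normValuation hv) := by
  rw [V.valuation_lt_one_iff] at ha
  change ν.normValuation hv (algebraMap K A a) < 1
  rw [Algebra.algebraMap_eq_smul_one, normValuation_smul_one]
  exact pow_lt_one₀ zero_le ha two_ne_zero

/-- The residue ring of the norm valuation, as an algebra over the residue field of the base. -/
abbrev residueAlgebra :
    Algebra (ResidueField V)
      ((ν.normValuation hv).integer ⧸ HypMfd.maximalIdeal (ν.normValuation hv)) :=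
  RingHom.toAlgebra' (Ideal.Quotient.lift (IsLocalRing.maximalIdeal V)
    ((Ideal.Quotient.mk _).comp (ν.integerScalar hv)) fun a ha =>
      Ideal.Quotient.eq_zero_iff_mem.2 (ν.integerScalar_mem_maximalIdeal hv ha)) <| by
    rintro ⟨a⟩ ⟨x⟩
    exact congrArg (Ideal.Quotient.mk _) (Subtype.ext (Algebra.commutes (a : K) (x : A)))

theorem exists_residue_sq_eq
    (x : (ν.normValuation hv).integer ⧸ HypMfd.maximalIdeal (ν.normValuation hv)) :
    letI := ν.residueAlgebra hv
    ∃ a b : ResidueField V, x ^ 2 = a • x + b • 1 := by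
  let := ν.residueAlgebra hv
  obtain ⟨x, rfl⟩ := Ideal.Quotient.mk_surjective x
  have htrace := (V.valuation_le_one_iff _).1 (ν.valuation_trace_le_one hv x.2)
  have hnorm := (V.valuation_le_one_iff _).1 x.2
  refine ⟨residue V ⟨_, htrace⟩, residue V (-⟨_, hnorm⟩), ?_⟩
  rw [Algebra.smul_def, Algebra.smul_def, mul_one]
  refine congrArg (Ideal.Quotient.mk _) (Subtype.ext ((ν.sq_eq x).trans ?_))
  change ν.trace x • (x : A) - ν.norm x • 1 =
    algebraMap K A (ν.trace x) * x + algebraMap K A (-ν.norm x)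
  rw [← Algebra.smul_def, Algebra.algebraMap_eq_smul_one, neg_smul, sub_eq_add_neg]

theorem natCast_mem_maximalIdeal [Finite (ResidueField V)] {p n : ℕ}
    (hcard : Nat.card (ResidueField V) = p ^ n) :
    (p : (ν.normValuation hv).integer) ∈ HypMfd.maximalIdeal (ν.normValuation hv) := by
  have hres : residue V (p : V) = 0 := by
    have := Fintype.ofFinite (ResidueField V)
    refine eq_zero_of_pow_eq_zero (n := n) ?_
    rw [map_natCast, ← Nat.cast_pow, ← hcard, Nat.card_eq_fintype_card]
    exact FiniteField.cast_card_eq_zero _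
  simpa using ν.integerScalar_mem_maximalIdeal hv ((residue_eq_zero_iff _).1 hres)

theorem sub_one_mem_or_add_one_mem_maximalIdeal [Finite (ResidueField V)]
    {G Q : Type*} [Group G] [Group Q] {f : G →* Q} (hf : Function.Surjective f)
    {ρ : G →* (ν.normValuation hv).integer} (hker : ∀ g ∈ f.ker, ρ g = 1 ∨ ρ g = -1)
    {h : ℕ} (hcop : h.Coprime (Nat.card (ResidueField V) ^ 2 - 1))
    (hcomm : ∀ γ : Q, γ ^ h ∈ commutator Q) (g : G) :
    ρ g - 1 ∈ HypMfd.maximalIdeal (ν.normValuation hv) ∨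
      ρ g + 1 ∈ HypMfd.maximalIdeal (ν.normValuation hv) := by
  let π := Ideal.Quotient.mk (HypMfd.maximalIdeal (ν.normValuation hv))
  let := ν.residueAlgebra hv
  have hπ := eq_one_or_eq_neg_one_of_sq_eq (ν.exists_residue_sq_eq hv) hf
    (ι := (π : _ →* _).comp ρ) (fun g hg => (hker g hg).imp
      (fun h => by simp [h]) (fun h => by simp [h])) hcop hcomm g
  rw [← sub_neg_eq_add, ← Ideal.Quotient.mk_eq_mk_iff_sub_mem,
    ← Ideal.Quotient.mk_eq_mk_iff_sub_mem]
  simpa using hπ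

end ReducedNorm

end

/-! ### Congruence subgroups -/

/-- A descending chain of normal subgroups of `G`, starting at `G`, whose successive quotients are
elementary abelian `p`-groups. -/
structure IsPFiltration {G : Type*} [Group G] (p : ℕ) (Λ : ℕ → Subgroup G) : Prop where
  zero_eq_top : Λ 0 = ⊤
  antitone : Antitone Λ
  normal : ∀ i, (Λ i).Normal
  commutator_le : ∀ i, ⁅Λ i, Λ i⁆ ≤ Λ (i + 1)
  powerSubgroup_le : ∀ i, powerSubgroup (Λ i) p ≤ Λ (i + 1)

namespace IsPFiltration

variable {G : Type*} [Group G] {p : ℕ} {Λ : ℕ → Subgroup G} (hΛ : IsPFiltration p Λ)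

include hΛ

theorem finiteIndex [Group.FG G] (hp : p ≠ 0) (i : ℕ) : (Λ i).FiniteIndex := by
  induction i with
  | zero => exact hΛ.zero_eq_top ▸ inferInstance
  | succ i _ =>
    exact finiteIndex_of_commutator_le (hΛ.commutator_le i) hp (hΛ.powerSubgroup_le i)

theorem pow_pow_mem (g : G) (i : ℕ) : g ^ p ^ i ∈ Λ i := by
  induction i with
  | zero => simp [hΛ.zero_eq_top]
  | succ i ih =>
    rw [pow_succ, pow_mul]
    exact hΛ.powerSubgroup_le i (pow_mem_powerSubgroup ih p)

end IsPFiltration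

section CongruenceSubgroup

variable {G R : Type*} [Group G] [Ring R] (ρ : G →* R)

/-- The subgroup of the elements that are congruent to `1` modulo a two-sided ideal. -/
def congruenceSubgroup (I : Ideal R) [I.IsTwoSided] : Subgroup G :=
  ((Ideal.Quotient.mk I : R →* R ⧸ I).comp ρ).ker

variable {ρ} {I J K : Ideal R} [I.IsTwoSided] [J.IsTwoSided] [K.IsTwoSided]

theorem mem_congruenceSubgroup {g : G} : g ∈ congruenceSubgroup ρ I ↔ ρ g - 1 ∈ I :=
  Ideal.Quotient.mk_eq_one_iff_sub_mem _

instance : (congruenceSubgroup ρ I).Normal := MonoidHom.normal_ker _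

theorem congruenceSubgroup_mono (h : I ≤ J) : congruenceSubgroup ρ I ≤ congruenceSubgroup ρ J :=
  fun _ hg => mem_congruenceSubgroup.2 (h (mem_congruenceSubgroup.1 hg))

theorem commutator_congruenceSubgroup_le (hIJ : I * J ≤ K) (hJI : J * I ≤ K) :
    ⁅congruenceSubgroup ρ I, congruenceSubgroup ρ J⁆ ≤ congruenceSubgroup ρ K := by
  refine Subgroup.commutator_le.2 fun g hg h hh => mem_congruenceSubgroup.2 ?_
  rw [mem_congruenceSubgroup] at hg hh
  have hcomm : ρ ⁅g, h⁆ - 1 =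
      ((ρ g - 1) * (ρ h - 1) - (ρ h - 1) * (ρ g - 1)) * ρ (h * g)⁻¹ :=
    calc ρ ⁅g, h⁆ - 1 = (ρ (g * h) - ρ (h * g)) * ρ (h * g)⁻¹ := by
          rw [sub_mul, ← map_mul, ← map_mul, mul_inv_cancel, map_one, commutatorElement_def,
            mul_inv_rev, mul_assoc (g * h)]
      _ = _ := by
          rw [map_mul, map_mul]
          congr 1
          noncomm_ring
  rw [hcomm]
  exact K.mul_mem_right _
    (K.sub_mem (hIJ (Ideal.mul_mem_mul hg hh)) (hJI (Ideal.mul_mem_mul hh hg)))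

theorem powerSubgroup_congruenceSubgroup_le {p : ℕ} (hIJ : I ≤ J) (hp : (p : R) ∈ J) :
    powerSubgroup (congruenceSubgroup ρ I) p ≤ congruenceSubgroup ρ (I * J) := by
  refine powerSubgroup_le_iff.2 fun g hg => mem_congruenceSubgroup.2 ?_
  have hsum : ∑ i ∈ Finset.range p, ρ g ^ i ∈ J := by
    have hg1 : Ideal.Quotient.mk J (ρ g) = 1 :=
      (Ideal.Quotient.mk_eq_one_iff_sub_mem _).2 (hIJ (mem_congruenceSubgroup.1 hg))
    rw [← Ideal.Quotient.eq_zero_iff_mem] at hp ⊢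
    simpa [map_sum, hg1] using hp
  rw [map_pow, ← mul_geom_sum]
  exact Ideal.mul_mem_mul (mem_congruenceSubgroup.1 hg) hsum

variable {Q : Type*} [Group Q] {f : G →* Q}

theorem isPFiltration_map_congruenceSubgroup (hf : Function.Surjective f)
    (hker : ∀ g, f g = 1 ↔ ρ g = 1 ∨ ρ g = -1) (hneg : ∃ ε, ρ ε = -1) {p : ℕ} (hp : (p : R) ∈ I)
    (hI : ∀ g, ρ g - 1 ∈ I ∨ ρ g + 1 ∈ I) :
    IsPFiltration p fun i => (congruenceSubgroup ρ (I ^ (i + 1))).map f where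
  zero_eq_top := by
    obtain ⟨ε, hε⟩ := hneg
    refine eq_top_iff.2 (hf.forall.2 fun g _ => ?_)
    have hpow : I ≤ I ^ (0 + 1) := (Submodule.pow_one I).ge
    rcases hI g with h | h
    · exact mem_map_of_mem f (mem_congruenceSubgroup.2 (hpow h))
    · refine ⟨ε * g, mem_congruenceSubgroup.2 ?_, by rw [map_mul, (hker ε).2 (.inr hε), one_mul]⟩
      rw [map_mul, hε, neg_one_mul, ← neg_add']
      exact neg_mem (hpow h)
  antitone i j hij :=
    map_mono (congruenceSubgroup_mono (Ideal.pow_le_pow_right (Nat.add_le_add_right hij 1)))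
  normal i := Normal.map inferInstance f hf
  commutator_le i := by
    have hle : I ^ (i + 1) * I ^ (i + 1) ≤ I ^ (i + 1 + 1) := by
      rw [Submodule.pow_succ]
      exact Ideal.mul_mono_right (Ideal.pow_le_self i.succ_ne_zero)
    rw [← map_commutator]
    exact map_mono (commutator_congruenceSubgroup_le hle hle)
  powerSubgroup_le i := by
    rw [← map_powerSubgroup]
    exact map_mono ((powerSubgroup_congruenceSubgroup_le (Ideal.pow_le_self i.succ_ne_zero)
      hp).trans (congruenceSubgroup_mono (Submodule.pow_succ I).ge))

theorem iInf_map_congruenceSubgroup_eq_bot (hker : ∀ g, f g = 1 ↔ ρ g = 1 ∨ ρ g = -1)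
    (hf : Function.Surjective f) (hI : ⨅ i : ℕ, I ^ i = ⊥) :
    ⨅ i : ℕ, (congruenceSubgroup ρ (I ^ (i + 1))).map f = ⊥ := by
  refine (eq_bot_iff_forall _).2 (hf.forall.2 fun g hg => (hker g).2 ?_)
  simp only [mem_iInf] at hg
  have hsign (i : ℕ) : ρ g - 1 ∈ I ^ (i + 1) ∨ ρ g + 1 ∈ I ^ (i + 1) := by
    obtain ⟨u, hu, hug⟩ := hg i
    rw [SetLike.mem_coe, mem_congruenceSubgroup] at hu
    have hg_eq : ρ g = ρ u * ρ (u⁻¹ * g) := by rw [← map_mul, mul_inv_cancel_left]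
    rcases (hker (u⁻¹ * g)).1 (by rw [map_mul, map_inv, hug, inv_mul_cancel]) with h | h
    · exact .inl (by rwa [hg_eq, h, mul_one])
    · refine .inr ?_
      rw [hg_eq, h, mul_neg_one, neg_add_eq_sub, ← neg_sub]
      exact neg_mem hu
  have hbot {x : R} (hx : ∀ i, x ∈ I ^ (i + 1)) : x = 0 := by
    rw [← Ideal.mem_bot, ← hI, Ideal.mem_iInf]
    exact fun i => Ideal.pow_le_pow_right i.le_succ (hx i)
  have hanti {i j : ℕ} (hij : i ≤ j) : I ^ (j + 1) ≤ I ^ (i + 1) :=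
    Ideal.pow_le_pow_right (Nat.add_le_add_right hij 1)
  by_cases h : ∀ i, ρ g - 1 ∈ I ^ (i + 1)
  · exact .inl (sub_eq_zero.1 (hbot h))
  · obtain ⟨i, hi⟩ := not_forall.1 h
    refine .inr (eq_neg_of_add_eq_zero_left (hbot fun j => hanti (le_max_right i j) ?_))
    exact (hsign (max i j)).resolve_left fun h => hi (hanti (le_max_left i j) h)

end CongruenceSubgroup

/-! ### The congruence filtration at a ramified prime -/

section Valuation

variable {A Γ₀ : Type*} [Ring A] [LinearOrderedCommGroupWithZero Γ₀] [MulArchimedean Γ₀]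
  {w : Valuation A Γ₀}

theorem iInf_maximalIdeal_pow_eq_bot (hw : ∀ x, w x = 0 → x = 0) {c : Γ₀} (hc : c < 1)
    (hgap : ∀ x, w x < 1 → w x ≤ c) : ⨅ i : ℕ, maximalIdeal w ^ i = ⊥ := by
  have hpow (i : ℕ) : maximalIdeal w ^ i ≤ w.leIdeal (c ^ i) := by
    induction i with
    | zero => exact fun x _ => Valuation.mem_leIdeal_iff.2 (by rw [pow_zero]; exact x.2)
    | succ i ih =>
      rw [Submodule.pow_succ, Ideal.mul_le]
      intro x hx y hy
      rw [Valuation.mem_leIdeal_iff, Subring.coe_mul, map_mul, pow_succ]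
      exact mul_le_mul' (Valuation.mem_leIdeal_iff.1 (ih hx)) (hgap y hy)
  refine eq_bot_iff.2 fun x hx => ?_
  by_contra hx0
  have hwx : w x ≠ 0 := mt (hw x) fun h => hx0 (Subtype.ext h)
  obtain ⟨i, hi⟩ := exists_pow_lt₀ hc (Units.mk0 _ hwx)
  exact hi.not_ge (Valuation.mem_leIdeal_iff.1 (hpow i ((Submodule.mem_iInf _).1 hx i)))

theorem exists_valuation_gap {K : Type*} [Field K] (V : ValuationSubring K)
    [IsDiscreteValuationRing V] : ∃ c < 1, ∀ x, V.valuation x < 1 → V.valuation x ≤ c := by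
  obtain ⟨ϖ, hϖ⟩ := IsDiscreteValuationRing.exists_irreducible V
  refine ⟨V.valuation ϖ, (V.valuation_lt_one_iff ϖ).1 hϖ.not_isUnit, fun x hx => ?_⟩
  have hxV := V.mem_of_valuation_le_one x hx.le
  have hdvd : ϖ ∣ ⟨x, hxV⟩ := by
    rw [← Ideal.mem_span_singleton, ← hϖ.maximalIdeal_eq]
    exact (V.valuation_lt_one_iff ⟨x, hxV⟩).2 hx
  obtain ⟨d, hd⟩ := hdvd
  exact (V.valuation_le_iff x ϖ).2 ⟨d, (mul_comm _ _).trans (congrArg Subtype.val hd).symm⟩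

end Valuation

theorem noZeroDivisors_of_forall_isUnit {R : Type*} [Ring R] (h : ∀ a : R, a ≠ 0 → IsUnit a) :
    NoZeroDivisors R where
  eq_zero_or_eq_zero_of_mul_eq_zero {a b} hab := by
    refine or_iff_not_imp_left.2 fun ha => ?_
    exact (h a ha).mul_right_eq_zero.1 hab

open scoped TensorProduct in
theorem ReducedNorm.exists_isPFiltration {K : Type} {A : Type*} [Field K] [Ring A] [Algebra K A]
    (ν : ReducedNorm K A) {V : ValuationSubring K} [IsDiscreteValuationRing V]
    (hunit : ∀ a : V.valuation.Completion ⊗[K] A, a ≠ 0 → IsUnit a)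
    {p n : ℕ} (hp : p ≠ 0) (hcard : Nat.card (IsLocalRing.ResidueField V) = p ^ n)
    {G Q : Type*} [Group G] [Group Q] {f : G →* Q} (hf : Function.Surjective f) {ρ : G →* A}
    (hnorm : ∀ g, ν.norm (ρ g) = 1) (hker : ∀ g, f g = 1 ↔ ρ g = 1 ∨ ρ g = -1)
    (hneg : ∃ ε, ρ ε = -1) {h : ℕ} (hcop : h.Coprime (p ^ (2 * n) - 1))
    (hcomm : ∀ γ : Q, γ ^ h ∈ commutator Q) :
    ∃ Λ : ℕ → Subgroup Q, IsPFiltration p Λ ∧ ⨅ i, Λ i = ⊥ := by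
  have := mulArchimedean_valueGroup V
  have := noZeroDivisors_of_forall_isUnit hunit
  have hinj : Function.Injective (Algebra.TensorProduct.includeRight :
      A →ₐ[K] V.valuation.Completion ⊗[K] A) :=
    Algebra.TensorProduct.includeRight_injective (algebraMap K _).injective
  have : NoZeroDivisors A := hinj.noZeroDivisors _ (map_zero _) (map_mul _)
  have : Finite (IsLocalRing.ResidueField V) :=
    Nat.finite_of_card_ne_zero (hcard ▸ pow_ne_zero n hp)
  have hv := ν.valuation_trace_sq_le (L := V.valuation.Completion) (v := V.valuation)
    fun a => Valued.valuedCompletion_apply _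
  let w := ν.normValuation hv
  let σ : G →* w.integer := ρ.codRestrict w.integer fun g =>
    ((congrArg V.valuation (hnorm g)).trans (map_one _)).le
  have hσ (g : G) : σ g = 1 ∨ σ g = -1 ↔ ρ g = 1 ∨ ρ g = -1 := by
    simp only [Subtype.ext_iff]; rfl
  have hker' (g : G) : f g = 1 ↔ σ g = 1 ∨ σ g = -1 := (hker g).trans (hσ g).symm
  have hmod := ν.sub_one_mem_or_add_one_mem_maximalIdeal hv hf (fun g => (hker' g).1)
    (by rwa [hcard, ← pow_mul, mul_comm n]) hcomm
  have hfil := isPFiltration_map_congruenceSubgroup hf hker'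
    (hneg.imp fun ε hε => Subtype.ext hε) (ν.natCast_mem_maximalIdeal hv hcard) hmod
  refine ⟨_, hfil, iInf_map_congruenceSubgroup_eq_bot hker' hf ?_⟩
  obtain ⟨c, hc, hgap⟩ := exists_valuation_gap V
  exact iInf_maximalIdeal_pow_eq_bot (fun x => (ν.normValuation_eq_zero_iff hv).1) hc
    fun x => hgap (ν.norm x)

noncomputable section

section MatrixAlgebra

variable {F : Type*} [Field F]

theorem sq_eq_trace_smul_sub_det_smul (x : Matrix (Fin 2) (Fin 2) F) :
    x ^ 2 = x.trace • x - x.det • 1 := by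
  have h := x.aeval_self_charpoly
  simp only [Matrix.charpoly_fin_two, map_add, map_sub, map_mul, map_pow, Polynomial.aeval_X,
    Polynomial.aeval_C, Algebra.algebraMap_eq_smul_one, smul_one_mul] at h
  rw [← sub_eq_zero, ← h]
  abel

theorem det_add_fin_two (x y : Matrix (Fin 2) (Fin 2) F) :
    (x + y).det = x.det + y.det + (x.trace * y.trace - (x * y).trace) := by
  simp only [Matrix.det_fin_two, Matrix.trace_fin_two, Matrix.mul_apply, Matrix.add_apply,
    Fin.sum_univ_two]
  ring

theorem two_mul_det_fin_two (x : Matrix (Fin 2) (Fin 2) F) :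
    2 * x.det = x.trace ^ 2 - (x ^ 2).trace := by
  simp only [Matrix.det_fin_two, Matrix.trace_fin_two, Matrix.mul_apply, Fin.sum_univ_two, sq]
  ring

variable {k : Type*} [Field k] [Algebra k F] {K : IntermediateField k F}
  {A : Subalgebra K (Matrix (Fin 2) (Fin 2) F)}

theorem det_mem_of_trace_mem [CharZero F] (htrace : ∀ x ∈ A, x.trace ∈ K)
    {x : Matrix (Fin 2) (Fin 2) F} (hx : x ∈ A) : x.det ∈ K := by
  rw [← mul_div_cancel_left₀ x.det (two_ne_zero' F), two_mul_det_fin_two]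
  exact div_mem (sub_mem (pow_mem (htrace x hx) 2) (htrace _ (pow_mem hx 2))) (natCast_mem K 2)

/-- The determinant on an algebra of `2 × 2` matrices over a field `K` containing their traces, with
values in `K`. -/
def detOfTraceMem [CharZero F] (htrace : ∀ x ∈ A, x.trace ∈ K) (x : A) : K :=
  ⟨x.1.det, det_mem_of_trace_mem htrace x.2⟩

theorem polar_detOfTraceMem [CharZero F] (htrace : ∀ x ∈ A, x.trace ∈ K) (x y : A) :
    (QuadraticMap.polar (detOfTraceMem htrace) x y).1 =
      x.1.trace * y.1.trace - (x.1 * y.1).trace := by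
  change (x.1 + y.1).det - x.1.det - y.1.det = _
  rw [det_add_fin_two]
  ring

/-- The determinant as a reduced norm. -/
def detReducedNorm [CharZero F] (htrace : ∀ x ∈ A, x.trace ∈ K) : ReducedNorm K A where
  norm := QuadraticMap.ofPolar (detOfTraceMem htrace)
    (fun a x => Subtype.ext <| by
      simp [detOfTraceMem, Matrix.det_smul_of_tower, IntermediateField.smul_def, sq])
    (fun x y z => Subtype.ext <| by
      simp only [AddMemClass.coe_add, polar_detOfTraceMem, Matrix.trace_add, add_mul]
      ring)
    (fun a x y => Subtype.ext <| by
      simp [polar_detOfTraceMem, IntermediateField.smul_def, mul_sub, mul_assoc])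
  norm_one := Subtype.ext Matrix.det_one
  norm_mul x y := Subtype.ext (Matrix.det_mul x.1 y.1)
  sq_eq x := Subtype.ext <| by
    have htrace_eq : (QuadraticMap.polar (detOfTraceMem htrace) x 1).1 = x.1.trace := by
      rw [polar_detOfTraceMem, OneMemClass.coe_one, mul_one, Matrix.trace_one, Fintype.card_fin]
      push_cast
      ring
    refine (sq_eq_trace_smul_sub_det_smul x.1).trans ?_
    rw [← htrace_eq]
    rfl

end MatrixAlgebra

theorem mem_center_fin_two_iff {R : Type*} [CommRing R] [IsDomain R]
    {g : Matrix.SpecialLinearGroup (Fin 2) R} :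
    g ∈ Subgroup.center (Matrix.SpecialLinearGroup (Fin 2) R) ↔ g.1 = 1 ∨ g.1 = -1 := by
  rw [Matrix.SpecialLinearGroup.mem_center_iff]
  simp only [Fintype.card_fin, sq_eq_one_iff, or_and_right, exists_or, exists_eq_left, map_one,
    map_neg, eq_comm (b := g.1)]

section KleinianGroup

variable (Γ : Subgroup PSL2C)

/-- The double cover of `Γ` by its preimage in `SL(2, ℂ)`. -/
abbrev liftProj : lift Γ →* Γ := (QuotientGroup.mk' (Subgroup.center SL2C)).subgroupComap Γ

theorem liftProj_surjective : Function.Surjective (liftProj Γ) :=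
  MonoidHom.subgroupComap_surjective_of_surjective _ Γ (QuotientGroup.mk'_surjective _)

theorem neg_one_mem_lift : (-1 : SL2C) ∈ lift Γ := by
  have h : QuotientGroup.mk' (Subgroup.center SL2C) (-1) = 1 :=
    (QuotientGroup.eq_one_iff _).2 (mem_center_fin_two_iff.2 (.inr rfl))
  rw [lift, Subgroup.mem_comap, h]
  exact one_mem Γ

/-- The inclusion of the preimage of `Γ` in the quaternion algebra. -/
def liftToQuatAlg : lift Γ →* quatAlg Γ where
  toFun g := ⟨g.1, Algebra.subset_adjoin ⟨g.1, g.2, rfl⟩⟩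
  map_one' := rfl
  map_mul' _ _ := rfl

theorem liftProj_eq_one_iff (g : lift Γ) :
    liftProj Γ g = 1 ↔ liftToQuatAlg Γ g = 1 ∨ liftToQuatAlg Γ g = -1 := by
  rw [Subtype.ext_iff, Subtype.ext_iff, Subtype.ext_iff]
  exact (QuotientGroup.eq_one_iff _).trans mem_center_fin_two_iff

variable {Γ}

theorem trace_mem_traceField {x : Matrix (Fin 2) (Fin 2) ℂ} (hx : x ∈ quatAlg Γ) :
    x.trace ∈ traceField Γ := by
  let S : Submonoid (Matrix (Fin 2) (Fin 2) ℂ) :=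
    (lift Γ).toSubmonoid.map Matrix.SpecialLinearGroup.coeMonoidHom
  have hS : {m : Matrix (Fin 2) (Fin 2) ℂ | ∃ g ∈ lift Γ, m = g.1} = S :=
    Set.ext fun m => exists_congr fun g => and_congr_right' eq_comm
  rw [quatAlg, hS, ← Subalgebra.mem_toSubmodule, Algebra.adjoin_eq_span, Submonoid.closure_eq] at hx
  induction hx using Submodule.span_induction with
  | mem x hx =>
    obtain ⟨g, hg, rfl⟩ := hx
    exact IntermediateField.subset_adjoin _ _ ⟨g, hg, rfl⟩
  | zero => exact Matrix.trace_zero (Fin 2) ℂ ▸ zero_mem _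
  | add x y _ _ hx hy => exact Matrix.trace_add x y ▸ add_mem hx hy
  | smul a x _ hx => exact Matrix.trace_smul a x ▸ (traceField Γ).mul_mem a.2 hx

theorem exists_isPFiltration_of_ramifies {p n h : ℕ} (hp : p ≠ 0)
    (hram : RamifiesAtPrimeOfNorm Γ (p ^ n)) (hcop : h.Coprime (p ^ (2 * n) - 1))
    (hcomm : ∀ γ : Γ, γ ^ h ∈ commutator Γ) :
    ∃ Λ : ℕ → Subgroup Γ, IsPFiltration p Λ ∧ ⨅ i, Λ i = ⊥ := by
  obtain ⟨V, hV, hcard, hunit⟩ := hram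
  have hnorm (g : lift Γ) :
      (detReducedNorm fun _ => trace_mem_traceField).norm (liftToQuatAlg Γ g) = 1 :=
    Subtype.ext g.1.det_coe
  have hneg : ∃ ε, liftToQuatAlg Γ ε = -1 := ⟨⟨-1, neg_one_mem_lift Γ⟩, rfl⟩
  exact ReducedNorm.exists_isPFiltration _ hunit hp hcard (liftProj_surjective Γ) hnorm
    (liftProj_eq_one_iff Γ) hneg hcop hcomm

end KleinianGroup

end

noncomputable section

open ContinuousMap stdSimplex

/-! ### Singular simplices in the base of a quotient covering -/

section Simplices

variable {X : Type} [TopologicalSpace X]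

instance (n : ℕ) : ContractibleSpace (stdSimplex ℝ (Fin (n + 1))) :=
  (convex_stdSimplex ℝ (Fin (n + 1))).contractibleSpace ⟨_, (vertex 0).2⟩

theorem stdSimplex_map_const {m n : ℕ} (j : Fin (n + 1)) (x : stdSimplex ℝ (Fin (m + 1))) :
    stdSimplex.map (fun _ => j) x = vertex j := by
  ext k
  rw [stdSimplex.map_coe, FunOnFinite.linearMap_apply_apply, vertex_coe]
  by_cases h : j = k
  · simp [← h]
  · simp [h]

theorem face_vertex {n : ℕ} (i : Fin (n + 2)) (σ : Simp X (n + 1)) (j : Fin (n + 1)) :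
    face i σ (vertex j) = σ (vertex (i.succAbove j)) :=
  congrArg σ (stdSimplex.map_vertex _ j)

theorem simp_zero_ext {σ τ : Simp X 0} (h : σ (vertex 0) = τ (vertex 0)) : σ = τ := by
  ext x
  rw [Subsingleton.elim x (vertex 0), h]

theorem boundary_single {R : Type} [CommRing R] {n : ℕ} (σ : Simp X (n + 1)) :
    boundary R X n (Finsupp.single σ 1) =
      ∑ i : Fin (n + 2), (-1 : R) ^ (i : ℕ) • Finsupp.single (face i σ) 1 := by
  simp [boundary]

theorem coboundary_zero_apply {R : Type} [CommRing R] (c : Simp X 0 → R) (σ : Simp X 1) :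
    coboundary R X 0 c σ = c (face 0 σ) - c (face 1 σ) := by
  simp [coboundary, sub_eq_add_neg]

theorem coboundary_one_apply {R : Type} [CommRing R] (c : Simp X 1 → R) (σ : Simp X 2) :
    coboundary R X 1 c σ = c (face 0 σ) - c (face 1 σ) + c (face 2 σ) := by
  simp [coboundary, sub_eq_add_neg, Fin.sum_univ_three]

theorem betti1_eq_zero_iff : betti1 X = 0 ↔ ∀ z : Simp X 1 → ℚ, coboundary ℚ X 1 z = 0 →
    ∃ c : Simp X 0 → ℚ, coboundary ℚ X 0 c = z := by
  rw [betti1, rank_zero_iff, Submodule.Quotient.subsingleton_iff, eq_top_iff]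
  exact ⟨fun h z hz => h (x := ⟨z, hz⟩) trivial, fun h z _ => h z.1 z.2⟩

end Simplices

variable {E X G : Type} [TopologicalSpace E] [TopologicalSpace X] [Group G] [MulAction G E]
  {p : E → X}

section Lift

variable {A : Type*} [TopologicalSpace A]

theorem exists_lift_of_contractibleSpace [ContractibleSpace A] (hp : IsCoveringMap p)
    (hsurj : p.Surjective) (f : C(A, X)) : ∃ F : C(A, E), ∀ a, p (F a) = f a := by
  obtain ⟨a₀, ⟨H⟩⟩ := id_nullhomotopic A
  obtain ⟨e, he⟩ := hsurj (f a₀)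
  let K : C(unitInterval × A, X) := f.comp H.symm.toContinuousMap
  have hK (a : A) : K (0, a) = p (ContinuousMap.const A e a) := by
    rw [ContinuousMap.const_apply, he]
    exact congrArg f (H.symm.apply_zero a)
  refine ⟨(hp.liftHomotopy K _ hK).comp ⟨fun a => (1, a), by fun_prop⟩, fun a => ?_⟩
  exact (congrFun (hp.liftHomotopy_lifts K _ hK) (1, a)).trans
    (congrArg f (H.symm.apply_one a))

theorem exists_eq_smul_of_lift [PreconnectedSpace A] [Nonempty A] (hp : IsQuotientCoveringMap p G)
    {F F' : C(A, E)} (h : ∀ a, p (F a) = p (F' a)) : ∃ g : G, ∀ a, F a = g • F' a := by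
  have := hp.toContinuousConstSMul
  let a₀ : A := Classical.arbitrary A
  obtain ⟨g, hg⟩ := hp.apply_eq_iff_mem_orbit.1 (h a₀)
  exact ⟨g, congrFun (hp.isCoveringMap.eq_of_comp_eq F.continuous (F'.continuous.const_smul g)
    (funext fun a => (h a).trans (hp.map_smul g).symm) a₀ hg.symm)⟩

theorem exists_lift_simp (hp : IsQuotientCoveringMap p G) {n : ℕ} (σ : Simp X n) :
    ∃ τ : Simp E n, ∀ a, p (τ a) = σ a :=
  exists_lift_of_contractibleSpace hp.isCoveringMap hp.surjective σ

end Lift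

/-! ### The deck cocycle and first homology -/

section DeckCocycle

variable (hp : IsQuotientCoveringMap p G)

theorem exists_smul_surjInv (e : E) : ∃ g : G, g • Function.surjInv hp.surjective (p e) = e :=
  hp.apply_eq_iff_mem_orbit.1 (Function.surjInv_eq hp.surjective (p e)).symm

/-- The deck transformation that takes the point chosen by `Function.surjInv` in the fibre of `e`
to `e`. -/
def deckElt (e : E) : G := (exists_smul_surjInv hp e).choose

theorem deckElt_smul_surjInv (e : E) :
    deckElt hp e • Function.surjInv hp.surjective (p e) = e :=
  (exists_smul_surjInv hp e).choose_spec

theorem deckElt_smul (g : G) (e : E) : deckElt hp (g • e) = g * deckElt hp e := by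
  have := hp.isCancelSMul
  refine IsCancelSMul.right_cancel _ _ (Function.surjInv hp.surjective (p e)) ?_
  rw [mul_smul, deckElt_smul_surjInv, ← hp.map_smul g, deckElt_smul_surjInv]

/-- The `1`-cocycle of a quotient covering with values in its (possibly nonabelian) group: it
compares the end points of a lift of `σ` with the chosen points of their fibres. -/
def deckCocycle (σ : Simp X 1) : G :=
  (deckElt hp ((exists_lift_simp hp σ).choose (vertex 0)))⁻¹ *
    deckElt hp ((exists_lift_simp hp σ).choose (vertex 1))

variable {hp}

theorem deckCocycle_eq {σ : Simp X 1} {τ : Simp E 1} (h : ∀ a, p (τ a) = σ a) :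
    deckCocycle hp σ = (deckElt hp (τ (vertex 0)))⁻¹ * deckElt hp (τ (vertex 1)) := by
  obtain ⟨g, hg⟩ := exists_eq_smul_of_lift hp (F := (exists_lift_simp hp σ).choose) (F' := τ)
    fun a => ((exists_lift_simp hp σ).choose_spec a).trans (h a).symm
  rw [deckCocycle, hg, hg, deckElt_smul, deckElt_smul]
  group

theorem deckCocycle_face_one (σ : Simp X 2) :
    deckCocycle hp (face 1 σ) = deckCocycle hp (face 2 σ) * deckCocycle hp (face 0 σ) := by
  obtain ⟨τ, hτ⟩ := exists_lift_simp hp σ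
  have hface (i : Fin 3) (a) : p (face i τ a) = face i σ a := hτ _
  simp only [deckCocycle_eq (hface _), face_vertex]
  rw [show (1 : Fin 3).succAbove (0 : Fin 2) = 0 from rfl,
    show (1 : Fin 3).succAbove (1 : Fin 2) = 2 from rfl,
    show (2 : Fin 3).succAbove (0 : Fin 2) = 0 from rfl,
    show (2 : Fin 3).succAbove (1 : Fin 2) = 1 from rfl,
    show (0 : Fin 3).succAbove (0 : Fin 2) = 1 from rfl,
    show (0 : Fin 3).succAbove (1 : Fin 2) = 2 from rfl]
  group

/-- A path, as a singular `1`-simplex. -/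
def pathSimp {x y : E} (γ : Path x y) : Simp E 1 :=
  γ.toContinuousMap.comp ⟨stdSimplexHomeomorphUnitInterval, Homeomorph.continuous _⟩

theorem pathSimp_vertex_zero {x y : E} (γ : Path x y) : pathSimp γ (vertex 0) = x := γ.source

theorem pathSimp_vertex_one {x y : E} (γ : Path x y) : pathSimp γ (vertex 1) = y := γ.target

variable (hp) in
theorem exists_loop_deckCocycle_eq [PathConnectedSpace E] (g : G) :
    ∃ σ : Simp X 1, face 0 σ = face 1 σ ∧ deckCocycle hp σ = g := by
  obtain ⟨e₀⟩ : Nonempty E := inferInstance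
  obtain ⟨e, he⟩ : ∃ e, deckElt hp e = 1 :=
    ⟨(deckElt hp e₀)⁻¹ • e₀, by rw [deckElt_smul, inv_mul_cancel]⟩
  let τ : Simp E 1 := pathSimp (PathConnectedSpace.somePath e (g • e))
  have hτ₀ : τ (vertex 0) = e := pathSimp_vertex_zero _
  have hτ₁ : τ (vertex 1) = g • e := pathSimp_vertex_one _
  refine ⟨(⟨p, hp.continuous⟩ : C(E, X)).comp τ, simp_zero_ext ?_, ?_⟩
  · rw [face_vertex, face_vertex]
    change p (τ (vertex 1)) = p (τ (vertex 0))
    rw [hτ₀, hτ₁, hp.map_smul]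
  · rw [deckCocycle_eq (τ := τ) fun _ => rfl, hτ₀, hτ₁, deckElt_smul, he, inv_one, one_mul, mul_one]

variable (hp) in
/-- The homomorphism from singular `1`-chains to the abelianization of the group of a quotient
covering that is induced by the deck cocycle. -/
def deckChainHom : (Simp X 1 →₀ ℤ) →ₗ[ℤ] Additive (Abelianization G) :=
  Finsupp.lift _ ℤ _ fun σ => Additive.ofMul (Abelianization.of (deckCocycle hp σ))

theorem deckChainHom_single (σ : Simp X 1) : deckChainHom hp (Finsupp.single σ 1) =
    Additive.ofMul (Abelianization.of (deckCocycle hp σ)) := by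
  simp [deckChainHom]

theorem deckChainHom_comp_boundary : deckChainHom hp ∘ₗ boundary ℤ X 1 = 0 := by
  ext σ
  rw [LinearMap.comp_apply, LinearMap.comp_apply, Finsupp.lsingle_apply, boundary_single, map_sum,
    Fin.sum_univ_three]
  simp only [map_smul, deckChainHom_single, deckCocycle_face_one σ, map_mul, ofMul_mul]
  simp

theorem pow_card_H1_mem_commutator [PathConnectedSpace E] (hp : IsQuotientCoveringMap p G) (g : G) :
    g ^ Nat.card (H1 X) ∈ commutator G := by
  let Ψ : H1 X →ₗ[ℤ] Additive (Abelianization G) :=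
    Submodule.liftQ _ ((deckChainHom hp).domRestrict (LinearMap.ker (boundary ℤ X 0))) (by
      rintro ⟨_, _⟩ ⟨d, rfl⟩
      exact LinearMap.congr_fun deckChainHom_comp_boundary d)
  obtain ⟨σ, hσ, hσg⟩ := exists_loop_deckCocycle_eq hp g
  have hcycle : Finsupp.single σ 1 ∈ LinearMap.ker (boundary ℤ X 0) := by
    rw [LinearMap.mem_ker, boundary_single, Fin.sum_univ_two, hσ]
    simp
  let ζ : H1 X := Submodule.Quotient.mk ⟨_, hcycle⟩
  have hζ : Ψ ζ = Additive.ofMul (Abelianization.of g) :=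
    (deckChainHom_single σ).trans (by rw [hσg])
  have hcard : Nat.card (H1 X) • Ψ ζ = 0 := by rw [← map_nsmul, card_nsmul_eq_zero', map_zero]
  rw [hζ, ← ofMul_pow, ← map_pow] at hcard
  exact (QuotientGroup.eq_one_iff _).1 (Additive.ofMul.injective hcard)

end DeckCocycle

/-! ### First rational cohomology of a quotient covering -/

theorem subsingleton_character_of_betti1_eq_zero [PathConnectedSpace E]
    (hp : IsQuotientCoveringMap p G) (h : betti1 X = 0) : Subsingleton (G →* Multiplicative ℚ) := by
  refine subsingleton_of_forall_eq 1 fun f => MonoidHom.ext fun g => ?_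
  obtain ⟨c, hc⟩ := betti1_eq_zero_iff.1 h (fun σ => (f (deckCocycle hp σ)).toAdd) (by
    ext σ
    rw [coboundary_one_apply, deckCocycle_face_one, map_mul, toAdd_mul, Pi.zero_apply]
    ring)
  obtain ⟨σ, hσ, hσg⟩ := exists_loop_deckCocycle_eq hp g
  have hval := congrFun hc σ
  rw [coboundary_zero_apply, hσ, sub_self, hσg] at hval
  exact hval.symm

section Primitive

variable {z : Simp X 1 → ℚ}

/-- The singular `1`-simplex of a square `Q` whose coordinates are the simplicial maps `f`, `g`. -/
def squareEdge (Q : C(stdSimplex ℝ (Fin 2) × stdSimplex ℝ (Fin 2), X)) (f g : Fin 2 → Fin 2) :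
    Simp X 1 :=
  Q.comp (.prodMk ⟨_, stdSimplex.continuous_map f⟩ ⟨_, stdSimplex.continuous_map g⟩)

theorem cocycle_triangle (hz : coboundary ℚ X 1 z = 0)
    (Q : C(stdSimplex ℝ (Fin 2) × stdSimplex ℝ (Fin 2), X)) (f g : Fin 3 → Fin 2) :
    z (squareEdge Q ![f 1, f 2] ![g 1, g 2]) - z (squareEdge Q ![f 0, f 2] ![g 0, g 2]) +
      z (squareEdge Q ![f 0, f 1] ![g 0, g 1]) = 0 := by
  let τ : Simp X 2 :=
    Q.comp (.prodMk ⟨_, stdSimplex.continuous_map f⟩ ⟨_, stdSimplex.continuous_map g⟩)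
  have hface (i : Fin 3) :
      face i τ = squareEdge Q (f ∘ i.succAbove) (g ∘ i.succAbove) := by
    ext x
    change Q (_, _) = Q (_, _)
    simp only [ContinuousMap.coe_mk, stdSimplex.map_comp_apply]
  have hcomp (i : Fin 3) (f : Fin 3 → Fin 2) :
      f ∘ i.succAbove = ![f (i.succAbove 0), f (i.succAbove 1)] := by
    ext j; fin_cases j <;> rfl
  have hτ : coboundary ℚ X 1 z τ = 0 := congrFun hz τ
  rw [coboundary_one_apply] at hτ
  simp only [hface, hcomp] at hτ
  exact hτ

theorem cocycle_const (hz : coboundary ℚ X 1 z = 0) (x : X) : z (.const _ x) = 0 := by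
  have h := congrFun hz (.const _ x)
  rw [coboundary_one_apply] at h
  simpa [show ∀ i, face i (.const _ x : Simp X 2) = .const _ x from fun _ => rfl] using h

theorem cocycle_square (hz : coboundary ℚ X 1 z = 0)
    (Q : C(stdSimplex ℝ (Fin 2) × stdSimplex ℝ (Fin 2), X)) :
    z (squareEdge Q ![0, 0] ![0, 1]) + z (squareEdge Q ![0, 1] ![1, 1]) =
      z (squareEdge Q ![0, 1] ![0, 0]) + z (squareEdge Q ![1, 1] ![0, 1]) := by
  have upper := cocycle_triangle hz Q ![0, 0, 1] ![0, 1, 1]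
  have lower := cocycle_triangle hz Q ![0, 1, 1] ![0, 0, 1]
  simp only [Matrix.cons_val] at upper lower
  linarith

theorem exists_primitive_of_contractibleSpace [ContractibleSpace E]
    (hz : coboundary ℚ X 1 z = 0) (q : C(E, X)) :
    ∃ H : E → ℚ, ∀ σ : Simp E 1, z (q.comp σ) = H (σ (vertex 1)) - H (σ (vertex 0)) := by
  obtain ⟨e₀, ⟨F⟩⟩ := id_nullhomotopic E
  let C : C(unitInterval × E, E) := F.symm.toContinuousMap
  have hC₀ (e : E) : C (0, e) = e₀ := F.symm.apply_zero e
  have hC₁ (e : E) : C (1, e) = e := F.symm.apply_one e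
  let ray (e : E) : Simp E 1 :=
    C.comp ⟨fun a => (stdSimplexHomeomorphUnitInterval a, e), by fun_prop⟩
  refine ⟨fun e => z (q.comp (ray e)), fun σ => ?_⟩
  let Q : C(stdSimplex ℝ (Fin 2) × stdSimplex ℝ (Fin 2), X) :=
    q.comp (C.comp ⟨fun x => (stdSimplexHomeomorphUnitInterval x.1, σ x.2), by fun_prop⟩)
  have hQ (f g : Fin 2 → Fin 2) (x) : squareEdge Q f g x =
    q (C (stdSimplexHomeomorphUnitInterval (stdSimplex.map f x), σ (stdSimplex.map g x))) := rfl
  have hid (x : stdSimplex ℝ (Fin 2)) : stdSimplex.map ![0, 1] x = x := by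
    rw [show ![(0 : Fin 2), 1] = id by ext i; fin_cases i <;> rfl, stdSimplex.map_id_apply]
  have hconst (j : Fin 2) (x : stdSimplex ℝ (Fin 2)) : stdSimplex.map ![j, j] x = vertex j := by
    rw [show ![j, j] = fun _ => j by ext i; fin_cases i <;> rfl, stdSimplex_map_const]
  have hu₀ : stdSimplexHomeomorphUnitInterval (vertex 0) = 0 := rfl
  have hu₁ : stdSimplexHomeomorphUnitInterval (vertex 1) = 1 := rfl
  have hleft : squareEdge Q ![0, 0] ![0, 1] = .const _ (q e₀) := by
    ext x; rw [hQ, hconst, hu₀, hC₀]; rfl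
  have hright : squareEdge Q ![1, 1] ![0, 1] = q.comp σ := by
    ext x; rw [hQ, hconst, hid, hu₁, hC₁]; rfl
  have hbot : squareEdge Q ![0, 1] ![0, 0] = q.comp (ray (σ (vertex 0))) := by
    ext x; rw [hQ, hconst, hid]; rfl
  have htop : squareEdge Q ![0, 1] ![1, 1] = q.comp (ray (σ (vertex 1))) := by
    ext x; rw [hQ, hconst, hid]; rfl
  have hsquare := cocycle_square hz Q
  rw [hleft, hright, hbot, htop, cocycle_const hz] at hsquare
  linarith

theorem primitive_smul_sub_eq [PathConnectedSpace E] (hp : IsQuotientCoveringMap p G)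
    {H : E → ℚ} (hH : ∀ σ : Simp E 1, z (comp ⟨p, hp.continuous⟩ σ) =
      H (σ (vertex 1)) - H (σ (vertex 0))) (g : G) (e e' : E) :
    H (g • e) - H e = H (g • e') - H e' := by
  have := hp.toContinuousConstSMul
  let σ : Simp E 1 := pathSimp (PathConnectedSpace.somePath e e')
  let gσ : Simp E 1 := comp ⟨fun x => g • x, continuous_const_smul g⟩ σ
  have hσ₀ : σ (vertex 0) = e := pathSimp_vertex_zero _
  have hσ₁ : σ (vertex 1) = e' := pathSimp_vertex_one _
  have hgσ : comp ⟨p, hp.continuous⟩ gσ = comp ⟨p, hp.continuous⟩ σ := by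
    ext a; exact hp.map_smul g
  have hz := hH gσ
  rw [hgσ, hH σ, hσ₀, hσ₁, show gσ (vertex 0) = g • e from congrArg (g • ·) hσ₀,
    show gσ (vertex 1) = g • e' from congrArg (g • ·) hσ₁] at hz
  linarith

end Primitive

theorem betti1_eq_zero_of_subsingleton_character [ContractibleSpace E]
    (hp : IsQuotientCoveringMap p G) [Subsingleton (G →* Multiplicative ℚ)] : betti1 X = 0 := by
  refine betti1_eq_zero_iff.2 fun z hz => ?_
  obtain ⟨H, hH⟩ := exists_primitive_of_contractibleSpace hz ⟨p, hp.continuous⟩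
  have hdiff := primitive_smul_sub_eq hp hH
  obtain ⟨e₀⟩ : Nonempty E := inferInstance
  let χ : G →* Multiplicative ℚ :=
    { toFun g := .ofAdd (H (g • e₀) - H e₀)
      map_one' := by rw [one_smul, sub_self, ofAdd_zero]
      map_mul' g h := by
        rw [← ofAdd_add, ← hdiff g (h • e₀) e₀, mul_smul, sub_add_sub_cancel] }
  have hinv (g : G) (e : E) : H (g • e) = H e := by
    refine sub_eq_zero.1 ((hdiff g e e₀).trans ?_)
    exact congrArg Multiplicative.toAdd (DFunLike.congr_fun (Subsingleton.elim χ 1) g)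
  have hfib {e e' : E} (h : p e = p e') : H e = H e' := by
    obtain ⟨g, rfl⟩ := hp.apply_eq_iff_mem_orbit.1 h
    exact hinv g e'
  refine ⟨fun σ => H (Function.surjInv hp.surjective (σ (vertex 0))), funext fun σ => ?_⟩
  obtain ⟨τ, hτ⟩ := exists_lift_simp hp σ
  have hσ : σ = comp ⟨p, hp.continuous⟩ τ := by ext a; exact (hτ a).symm
  rw [coboundary_zero_apply, face_vertex, face_vertex, hσ, hH]
  exact congrArg₂ _ (hfib (Function.surjInv_eq _ _)) (hfib (Function.surjInv_eq _ _))

end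

open Matrix
open scoped ComplexOrder NNReal

/-! ### Hyperbolic 3-space and its quotients -/

section Matrix

variable {m n : Type*} [Fintype n]

theorem ofReal_re_trace {P : Matrix n n ℂ} (hP : P.IsHermitian) : (P.trace.re : ℂ) = P.trace :=
  Complex.conj_eq_iff_re.1 (by rw [starRingEnd_apply, ← trace_conjTranspose, hP.eq])

theorem posDef_of_det_eq_one_of_trace_nonneg {P : Matrix (Fin 2) (Fin 2) ℂ} (hP : P.IsHermitian)
    (hdet : P.det = 1) (htr : 0 ≤ P.trace.re) : P.PosDef := by
  have hposDef : (P.trace • P).PosDef := by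
    have hsq : P.trace • P = 1 + P * Pᴴ := by
      rw [hP.eq, ← sq, sq_eq_trace_smul_sub_det_smul, hdet, one_smul, add_sub_cancel]
    rw [hsq]
    exact PosDef.one.add_posSemidef (posSemidef_self_mul_conjTranspose P)
  have hne : P.trace ≠ 0 := fun h0 => by
    have hdet_pos := hposDef.det_pos
    simp [h0] at hdet_pos
  have hre : 0 < P.trace.re := htr.lt_of_ne fun h0 => hne (by rw [← ofReal_re_trace hP, ← h0]; rfl)
  have h_eq : P = (P.trace.re)⁻¹ • (P.trace • P) := by
    rw [← Complex.coe_smul, smul_smul, Complex.ofReal_inv, ofReal_re_trace hP,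
      inv_mul_cancel₀ hne, one_smul]
  exact h_eq ▸ hposDef.smul (inv_pos.2 hre)

variable [Fintype m]

theorem norm_sq_le_re_trace_mul_conjTranspose (A : Matrix m n ℂ) (i : m) (j : n) :
    ‖A i j‖ ^ 2 ≤ (A * Aᴴ).trace.re := by
  have hsum : (A * Aᴴ).trace.re = ∑ i, ∑ j, ‖A i j‖ ^ 2 := by
    simp only [trace, diag_apply, mul_apply, conjTranspose_apply, Complex.star_def,
      Complex.mul_conj, Complex.re_sum, Complex.ofReal_re, Complex.normSq_eq_norm_sq]
  rw [hsum]
  calc ‖A i j‖ ^ 2 ≤ ∑ j, ‖A i j‖ ^ 2 :=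
        Finset.single_le_sum (f := fun j => ‖A i j‖ ^ 2) (fun _ _ => sq_nonneg _)
          (Finset.mem_univ j)
    _ ≤ ∑ i, ∑ j, ‖A i j‖ ^ 2 :=
        Finset.single_le_sum (f := fun i => ∑ j, ‖A i j‖ ^ 2)
          (fun _ _ => Finset.sum_nonneg fun _ _ => sq_nonneg _) (Finset.mem_univ i)

theorem isCompact_setOf_re_trace_mul_conjTranspose_le (C : ℝ) :
    IsCompact {A : Matrix m n ℂ | (A * Aᴴ).trace.re ≤ C} := by
  have hbox : IsCompact (Set.univ.pi fun _ => Set.univ.pi fun _ => Metric.closedBall 0 √C :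
      Set (Matrix m n ℂ)) :=
    isCompact_univ_pi fun _ => isCompact_univ_pi fun _ => isCompact_closedBall 0 √C
  refine hbox.of_isClosed_subset (isClosed_le (by fun_prop) continuous_const) fun A hA i _ j _ => ?_
  rw [mem_closedBall_zero_iff]
  exact Real.le_sqrt_of_sq_le ((norm_sq_le_re_trace_mul_conjTranspose A i j).trans hA)

end Matrix

section HyperbolicSpace

/-- The trace of a point of `ℍ³`; it is twice the hyperbolic cosine of the distance to the identity
matrix, and therefore serves as a proper height function. -/
noncomputable def trH (P : H3) : ℝ := (trace P.1).re

theorem ofReal_trH (P : H3) : (trH P : ℂ) = trace P.1 := ofReal_re_trace P.2.1.isHermitian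

theorem trH_pos (P : H3) : 0 < trH P := (Complex.pos_iff.1 P.2.1.trace_pos).1

theorem continuous_trH : Continuous trH :=
  Complex.continuous_re.comp continuous_subtype_val.matrix_trace

theorem trH_smul_eq_mul_self_add_one (P : H3) : (trH P : ℂ) • P.1 = P.1 * P.1 + 1 := by
  rw [← sq, sq_eq_trace_smul_sub_det_smul, P.2.2, one_smul, ofReal_trH, sub_add_cancel]

theorem isClosedEmbedding_H3_val : IsClosedEmbedding (fun P : H3 => P.1) := by
  refine ⟨IsEmbedding.subtypeVal, ?_⟩
  have hrange : Set.range (fun P : H3 => P.1) =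
      {P | Pᴴ = P ∧ P.det = 1 ∧ 0 ≤ P.trace.re} := by
    ext P
    constructor
    · rintro ⟨Q, rfl⟩
      exact ⟨Q.2.1.isHermitian.eq, Q.2.2, (trH_pos Q).le⟩
    · rintro ⟨hP, hdet, htr⟩
      exact ⟨⟨P, posDef_of_det_eq_one_of_trace_nonneg hP hdet htr, hdet⟩, rfl⟩
  rw [hrange]
  exact (isClosed_eq continuous_id.matrix_conjTranspose continuous_id).inter
    ((isClosed_eq continuous_id.matrix_det continuous_const).inter
    (isClosed_le continuous_const (Complex.continuous_re.comp continuous_id.matrix_trace)))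

instance : T2Space H3 := isClosedEmbedding_H3_val.isEmbedding.t2Space

instance : LocallyCompactSpace H3 :=
  have : LocallyCompactSpace (Matrix (Fin 2) (Fin 2) ℂ) :=
    inferInstanceAs (LocallyCompactSpace (Fin 2 → Fin 2 → ℂ))
  isClosedEmbedding_H3_val.locallyCompactSpace

theorem re_trace_mul_conjTranspose_le (g : SL2C) (P : H3) :
    (g.1 * g.1ᴴ).trace.re ≤ trH P * trH (g • P) := by
  have hmul : (trH P : ℂ) • (g.1 * P.1 * g.1ᴴ) = (g.1 * P.1) * (g.1 * P.1)ᴴ + g.1 * g.1ᴴ := by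
    rw [← smul_mul_assoc, ← mul_smul_comm, trH_smul_eq_mul_self_add_one, conjTranspose_mul,
      P.2.1.isHermitian.eq]
    noncomm_ring
  have htrace : trH P * trH (g • P) =
      ((g.1 * P.1) * (g.1 * P.1)ᴴ).trace.re + (g.1 * g.1ᴴ).trace.re := by
    rw [← Complex.add_re, ← trace_add, ← hmul, trace_smul, smul_eq_mul, Complex.re_ofReal_mul]
    rfl
  have hnonneg := (Complex.nonneg_iff.1
    (posSemidef_self_mul_conjTranspose (g.1 * P.1)).trace_nonneg).1
  linarith

theorem trH_le_trH_mul_re_trace (P Q : H3) : trH Q ≤ trH P * (P.1⁻¹ * Q.1).trace.re := by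
  have hunit : IsUnit P.1.det := by rw [P.2.2]; exact isUnit_one
  have hinv : (trH P : ℂ) • P.1⁻¹ = P.1⁻¹ * P.1⁻¹ + 1 := by
    have h := congrArg (P.1⁻¹ * P.1⁻¹ * ·) (trH_smul_eq_mul_self_add_one P)
    simp only [mul_smul_comm, Matrix.mul_assoc, mul_add, nonsing_inv_mul_cancel_left _ _ hunit,
      nonsing_inv_mul _ hunit, mul_one] at h
    rw [h, add_comm]
  have htrace : trH P * (P.1⁻¹ * Q.1).trace.re =
      (P.1⁻¹ * (P.1⁻¹ * Q.1)).trace.re + trH Q := by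
    rw [← Complex.re_ofReal_mul, ← smul_eq_mul, ← trace_smul, ← smul_mul_assoc, hinv, add_mul,
      trace_add, Complex.add_re, Matrix.mul_assoc, Matrix.one_mul]
    rfl
  have hpsd := (Q.2.1.posSemidef.mul_mul_conjTranspose_same P.1⁻¹).trace_nonneg
  rw [P.2.1.isHermitian.inv.eq, trace_mul_comm] at hpsd
  linarith [(Complex.nonneg_iff.1 hpsd).1]

theorem trH_le_of_hdist_lt {P Q : H3} {r : ℝ} (h : hdist P Q < r) :
    trH Q ≤ trH P * (2 * Real.cosh r) := by
  refine (trH_le_trH_mul_re_trace P Q).trans (mul_le_mul_of_nonneg_left ?_ (trH_pos P).le)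
  suffices (P.1⁻¹ * Q.1).trace.re / 2 ≤ Real.cosh r by linarith
  rcases le_total 1 ((P.1⁻¹ * Q.1).trace.re / 2) with hone | hone
  · rw [← Real.cosh_arcosh hone]
    refine Real.cosh_le_cosh.2 ?_
    rw [abs_of_nonneg (Real.arcosh_nonneg hone)]
    exact h.le.trans (le_abs_self r)
  · exact hone.trans (Real.one_le_cosh r)

theorem hdist_smul_smul (γ : PSL2C) (P Q : H3) : hdist (γ • P) (γ • Q) = hdist P Q := by
  obtain ⟨g, rfl⟩ := QuotientGroup.mk_surjective γ
  have hg : IsUnit g.1.det := by rw [g.2]; exact isUnit_one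
  have hg' : IsUnit (g.1ᴴ).det := by rw [det_conjTranspose, g.2, star_one]; exact isUnit_one
  have hinv : (g.1 * P.1 * g.1ᴴ)⁻¹ * (g.1 * Q.1 * g.1ᴴ) = (g.1ᴴ)⁻¹ * ((P.1⁻¹ * Q.1) * g.1ᴴ) := by
    rw [Matrix.mul_inv_rev, Matrix.mul_inv_rev]
    simp only [Matrix.mul_assoc]
    rw [nonsing_inv_mul_cancel_left _ _ hg]
  change Real.arcosh ((trace ((g.1 * P.1 * g.1ᴴ)⁻¹ * (g.1 * Q.1 * g.1ᴴ))).re / 2) = _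
  rw [hinv, trace_mul_comm, Matrix.mul_assoc, mul_nonsing_inv _ hg', Matrix.mul_one]
  rfl

instance : ContinuousConstSMul PSL2C H3 where
  continuous_const_smul γ := by
    obtain ⟨g, rfl⟩ := QuotientGroup.mk_surjective γ
    exact Continuous.subtype_mk (p := fun P : Matrix (Fin 2) (Fin 2) ℂ => P.PosDef ∧ P.det = 1)
      ((continuous_const.matrix_mul continuous_subtype_val).matrix_mul continuous_const) _

instance (Γ : Subgroup PSL2C) : ContinuousConstSMul Γ H3 :=
  ⟨fun γ => continuous_const_smul γ.1⟩

instance : T2Space PSL2C := by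
  have hcenter : IsClosed (Subgroup.center SL2C : Set SL2C) := by
    rw [Subgroup.coe_center, ← Set.centralizer_univ]
    exact Set.isClosed_centralizer _
  exact inferInstanceAs (T2Space (SL2C ⧸ Subgroup.center SL2C))

end HyperbolicSpace

section Discrete

variable (Γ : Subgroup PSL2C) [DiscreteTopology Γ]

theorem finite_setOf_trH_le (B : ℝ) : {γ : Γ | ∃ P : H3, trH P ≤ B ∧ trH (γ • P) ≤ B}.Finite := by
  have hK : IsCompact {g : SL2C | (g.1 * g.1ᴴ).trace.re ≤ B * B} :=
    SpecialLinearGroup.isClosedEmbedding_val.isCompact_preimage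
      (isCompact_setOf_re_trace_mul_conjTranspose_le (B * B))
  have hKΓ := (Subgroup.isClosed_of_discrete (H := Γ)).isClosedEmbedding_subtypeVal
    |>.isCompact_preimage (hK.image (continuous_quot_mk : Continuous (QuotientGroup.mk (s := _))))
  refine hKΓ.finite_of_discrete.subset ?_
  rintro ⟨γ, hγ⟩ ⟨P, hP, hγP⟩
  obtain ⟨g, rfl⟩ := QuotientGroup.mk_surjective γ
  exact ⟨g, (re_trace_mul_conjTranspose_le g P).trans
    (mul_le_mul hP hγP (trH_pos _).le ((trH_pos P).le.trans hP)), rfl⟩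

instance : ProperlyDiscontinuousSMul Γ H3 where
  finite_disjoint_inter_image {K L} hK hL := by
    obtain ⟨B, hB⟩ := ((hK.union hL).image continuous_trH).bddAbove
    refine (finite_setOf_trH_le Γ B).subset ?_
    rintro γ ⟨_, ⟨P, hP, rfl⟩, hL'⟩
    exact ⟨P, hB ⟨P, .inl hP, rfl⟩, hB ⟨_, .inr hL', rfl⟩⟩

end Discrete

theorem isCancelSMul_of_forall_isOfFinOrder {G X : Type*} [Group G] [MulAction G X]
    [TopologicalSpace X] [ProperlyDiscontinuousSMul G X] (htf : ∀ g : G, IsOfFinOrder g → g = 1) :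
    IsCancelSMul G X := by
  refine isCancelSMul_iff_eq_one_of_smul_eq.2 fun g x hg => htf g ?_
  have : Finite (MulAction.stabilizer G x) := ProperlyDiscontinuousSMul.finite_stabilizer x
  exact Submonoid.isOfFinOrder_coe.2
    (isOfFinOrder_of_finite (⟨g, hg⟩ : MulAction.stabilizer G x))

theorem isQuotientCoveringMap_Mfd {Γ : Subgroup PSL2C} [DiscreteTopology Γ]
    (htf : ∀ g ∈ Γ, IsOfFinOrder g → g = 1) :
    IsQuotientCoveringMap (fun P : H3 => (Quotient.mk'' P : Mfd Γ)) Γ :=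
  have := isCancelSMul_of_forall_isOfFinOrder (X := H3) fun (γ : Γ) hγ =>
    Subtype.ext (htf γ γ.2 (Submonoid.isOfFinOrder_coe.2 hγ))
  isQuotientCoveringMap_quotientMk_of_properlyDiscontinuousSMul

section Contraction

/-- The determinant of the point `(1 - t) + t P` of the segment from the identity matrix to `P`. -/
noncomputable def segmentDet (t : ℝ) (P : H3) : ℝ := (1 - t) ^ 2 + t * (1 - t) * trH P + t ^ 2

/-- The point at time `t` of the segment from the identity matrix to `P`, rescaled to have
determinant one. -/
noncomputable def segmentMatrix (t : ℝ) (P : H3) : Matrix (Fin 2) (Fin 2) ℂ :=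
  (√(segmentDet t P))⁻¹ • ((1 - t) • (1 : Matrix (Fin 2) (Fin 2) ℂ) + t • P.1)

theorem det_segment (t : ℝ) (P : H3) :
    ((1 - t) • (1 : Matrix (Fin 2) (Fin 2) ℂ) + t • P.1).det = segmentDet t P := by
  have htrace : P.1 0 0 + P.1 1 1 = trH P := by rw [ofReal_trH, trace_fin_two]
  have hdet : P.1 0 0 * P.1 1 1 - P.1 0 1 * P.1 1 0 = 1 := by rw [← det_fin_two, P.2.2]
  simp only [det_fin_two, segmentDet, Matrix.add_apply, Matrix.smul_apply, one_apply_eq,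
    Complex.real_smul, Complex.ofReal_sub, Complex.ofReal_one, mul_one, ne_eq,
    Fin.zero_eq_one_iff, Fin.one_eq_zero_iff, OfNat.ofNat_ne_one, not_false_eq_true, one_apply_ne,
    mul_zero, zero_add, Complex.ofReal_add, Complex.ofReal_pow, Complex.ofReal_mul]
  linear_combination (t * (1 - t) : ℂ) * htrace + (t ^ 2 : ℂ) * hdet

section

variable {t : ℝ} (h0 : 0 ≤ t) (h1 : t ≤ 1) (P : H3)
include h0 h1

theorem segmentDet_pos : 0 < segmentDet t P := by
  have hmul : 0 ≤ t * (1 - t) * trH P :=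
    mul_nonneg (mul_nonneg h0 (sub_nonneg.2 h1)) (trH_pos P).le
  unfold segmentDet
  nlinarith [sq_nonneg (1 - t - t)]

theorem det_segmentMatrix : (segmentMatrix t P).det = 1 := by
  have hpos := segmentDet_pos h0 h1 P
  rw [segmentMatrix, ← Complex.coe_smul, det_smul, det_segment, Fintype.card_fin,
    ← Complex.ofReal_pow, ← Complex.ofReal_mul, inv_pow, Real.sq_sqrt hpos.le,
    inv_mul_cancel₀ hpos.ne', Complex.ofReal_one]

theorem posDef_segmentMatrix : (segmentMatrix t P).PosDef := by
  refine posDef_of_det_eq_one_of_trace_nonneg ?_ (det_segmentMatrix h0 h1 P) ?_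
  · simp only [IsHermitian, segmentMatrix, conjTranspose_smul, conjTranspose_add,
      conjTranspose_one, P.2.1.isHermitian.eq, star_trivial]
  · have htrace : (segmentMatrix t P).trace.re =
        (√(segmentDet t P))⁻¹ * ((1 - t) * 2 + t * trH P) := by
      simp [segmentMatrix, ← ofReal_trH, mul_add]
    rw [htrace]
    exact mul_nonneg (inv_nonneg.2 (Real.sqrt_nonneg _))
      (add_nonneg (mul_nonneg (sub_nonneg.2 h1) two_pos.le) (mul_nonneg h0 (trH_pos P).le))

end

theorem continuous_segmentMatrix :
    Continuous fun x : unitInterval × H3 => segmentMatrix x.1 x.2 := by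
  have ht : Continuous fun x : unitInterval × H3 => (x.1 : ℝ) :=
    continuous_subtype_val.comp continuous_fst
  have htrH : Continuous fun x : unitInterval × H3 => trH x.2 := continuous_trH.comp continuous_snd
  have hval : Continuous fun x : unitInterval × H3 => x.2.1 :=
    continuous_subtype_val.comp continuous_snd
  have hdet : Continuous fun x : unitInterval × H3 => segmentDet x.1 x.2 := by
    unfold segmentDet
    fun_prop
  have hscale : Continuous fun x : unitInterval × H3 => (√(segmentDet x.1 x.2))⁻¹ :=
    hdet.sqrt.inv₀ fun x => (Real.sqrt_pos.2 (segmentDet_pos x.1.2.1 x.1.2.2 x.2)).ne'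
  exact hscale.smul (((continuous_const.sub ht).smul continuous_const).add (ht.smul hval))

instance : ContractibleSpace H3 :=
  (contractible_iff_id_nullhomotopic H3).2
    ⟨⟨1, PosDef.one, det_one⟩, ⟨ContinuousMap.Homotopy.symm
      { toFun := fun x => ⟨segmentMatrix x.1 x.2, posDef_segmentMatrix x.1.2.1 x.1.2.2 x.2,
          det_segmentMatrix x.1.2.1 x.1.2.2 x.2⟩
        continuous_toFun := Continuous.subtype_mk
          (p := fun P : Matrix (Fin 2) (Fin 2) ℂ => P.PosDef ∧ P.det = 1)
          continuous_segmentMatrix _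
        map_zero_left := fun P => Subtype.ext
          (show segmentMatrix (0 : ℝ) P = 1 by simp [segmentMatrix, segmentDet])
        map_one_left := fun P => Subtype.ext
          (show segmentMatrix (1 : ℝ) P = P.1 by simp [segmentMatrix, segmentDet]) }⟩⟩

end Contraction

/-! ### Cocompact actions and the injectivity radius -/

section Generation

variable {G X : Type*} [Group G] [TopologicalSpace X] [PreconnectedSpace X] [MulAction G X]
  [ContinuousConstSMul G X] {U : Set X}

theorem closure_setOf_exists_smul_mem_eq_top (hU : IsOpen U) (hne : U.Nonempty)
    (hcover : ∀ x, ∃ g : G, g • x ∈ U) :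
    Subgroup.closure {g : G | ∃ x ∈ U, g • x ∈ U} = ⊤ := by
  set H := Subgroup.closure {g : G | ∃ x ∈ U, g • x ∈ U}
  let T (A : Set G) : Set X := ⋃ g ∈ A, (g • ·) ⁻¹' U
  have hT : ∀ A, IsOpen (T A) := fun A =>
    isOpen_biUnion fun g _ => hU.preimage (continuous_const_smul g)
  have hTne : ∀ {A : Set G}, A.Nonempty → (Set.univ ∩ T A).Nonempty := by
    rintro A ⟨g, hg⟩
    obtain ⟨x, hx⟩ := hne
    exact ⟨g⁻¹ • x, trivial, Set.mem_biUnion hg (by rwa [Set.mem_preimage, smul_inv_smul])⟩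
  have huniv : Set.univ ⊆ T H ∪ T (H : Set G)ᶜ := fun x _ => by
    obtain ⟨g, hg⟩ := hcover x
    exact (em (g ∈ H)).imp (fun h => Set.mem_biUnion h hg) (fun h => Set.mem_biUnion h hg)
  by_contra hH
  obtain ⟨g, hg⟩ : ∃ g, g ∉ H := by simpa [Subgroup.eq_top_iff'] using hH
  obtain ⟨x, -, hxH, hxHc⟩ := isPreconnected_univ (T H) (T (H : Set G)ᶜ) (hT _) (hT _) huniv
    (hTne ⟨1, H.one_mem⟩) (hTne ⟨g, hg⟩)
  obtain ⟨a, ha, hax⟩ := Set.mem_iUnion₂.1 hxH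
  obtain ⟨b, hb, hbx⟩ := Set.mem_iUnion₂.1 hxHc
  have hba : b * a⁻¹ ∈ H :=
    Subgroup.subset_closure ⟨a • x, hax, by rwa [mul_smul, inv_smul_smul]⟩
  exact hb (by simpa using H.mul_mem hba ha)

end Generation

section Cocompact

variable {Γ : Subgroup PSL2C}

theorem exists_trH_smul_le (h : CompactSpace (Mfd Γ)) :
    ∃ R : ℝ, ∀ x : H3, ∃ γ : Γ, trH (γ • x) ≤ R := by
  let π : H3 → Mfd Γ := Quotient.mk''
  have hopen : IsOpenMap π := isOpenMap_quotient_mk'_mul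
  obtain ⟨n, hn⟩ := isCompact_univ.elim_directed_cover (fun n : ℕ => π '' {P | trH P < n})
    (fun n => hopen _ (isOpen_lt continuous_trH continuous_const))
    (fun q _ => by
      induction q using Quotient.inductionOn' with
      | h x =>
        obtain ⟨n, hn⟩ := exists_nat_gt (trH x)
        exact Set.mem_iUnion.2 ⟨n, x, hn, rfl⟩)
    (directed_of_isDirected_le fun m n hmn => Set.image_mono fun P (hP : trH P < m) =>
      hP.trans_le (Nat.cast_le.2 hmn))
  refine ⟨n, fun x => ?_⟩
  obtain ⟨y, hy, hyx⟩ := hn (Set.mem_univ (π x))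
  obtain ⟨γ, rfl⟩ := MulAction.orbitRel_apply.1 (Quotient.exact' hyx)
  exact ⟨γ, le_of_lt hy⟩

theorem fg_of_compactSpace_Mfd [DiscreteTopology Γ] (h : CompactSpace (Mfd Γ)) : Group.FG Γ := by
  obtain ⟨R, hR⟩ := exists_trH_smul_le h
  have hcover : ∀ x, ∃ γ : Γ, γ • x ∈ {P | trH P < R + 1} := fun x =>
    (hR x).imp fun γ hγ => hγ.trans_lt (lt_add_one R)
  have hne : {P | trH P < R + 1}.Nonempty :=
    (hcover (Classical.arbitrary H3)).elim fun γ hγ => ⟨_, hγ⟩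
  refine Group.fg_iff.2 ⟨_, closure_setOf_exists_smul_mem_eq_top
    (isOpen_lt continuous_trH continuous_const) hne hcover, ?_⟩
  exact (finite_setOf_trH_le Γ (R + 1)).subset fun γ ⟨P, hP, hγP⟩ => ⟨P, le_of_lt hP, le_of_lt hγP⟩

end Cocompact

section InjectivityRadius

variable {Γ : Subgroup PSL2C}

theorem le_injRad_map_subtype {R : ℝ} (hR : ∀ x : H3, ∃ γ : Γ, trH (γ • x) ≤ R) (N : Subgroup Γ)
    [N.Normal] (r : ℝ≥0)
    (hN : ∀ γ ∈ N, (∃ P, trH P ≤ R * (2 * Real.cosh r) ∧ trH (γ • P) ≤ R * (2 * Real.cosh r)) →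
      γ = 1) :
    r ≤ injRad (N.map Γ.subtype) := by
  refine le_iSup₂_of_le r (fun x y hy z hz hyz => ?_) le_rfl
  obtain ⟨⟨_, γ, hγN, rfl⟩, hγ : γ • z = y⟩ := MulAction.orbitRel_apply.1 (Quotient.exact' hyz)
  obtain ⟨δ, hδ⟩ := hR x
  have hbound : ∀ w, hdist x w < r → trH (δ • w) ≤ R * (2 * Real.cosh r) := fun w hw => by
    rw [← hdist_smul_smul δ.1] at hw
    exact (trH_le_of_hdist_lt hw).trans
      (mul_le_mul_of_nonneg_right hδ (mul_pos two_pos (Real.cosh_pos r)).le)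
  have hconj : δ * γ * δ⁻¹ = 1 := by
    refine hN _ (Subgroup.Normal.conj_mem ‹_› γ hγN δ) ⟨δ • z, hbound z hz, ?_⟩
    rw [mul_smul, mul_smul, inv_smul_smul, hγ]
    exact hbound y hy
  rw [← hγ, conj_eq_one_iff.1 hconj, one_smul]

theorem eventually_mem_imp_eq_one {G : Type*} [Group G] {Λ : ℕ → Subgroup G} (hanti : Antitone Λ)
    (hbot : ⨅ k, Λ k = ⊥) (g : G) : ∀ᶠ k in Filter.atTop, g ∈ Λ k → g = 1 := by
  by_cases hg : ∀ k, g ∈ Λ k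
  · exact .of_forall fun _ _ => Subgroup.mem_bot.1 (hbot ▸ Subgroup.mem_iInf.2 hg)
  · obtain ⟨k, hk⟩ := not_forall.1 hg
    filter_upwards [Filter.eventually_ge_atTop k] with l hl h
    exact absurd (hanti hl h) hk

theorem tendsto_injRad_map_subtype [DiscreteTopology Γ] (h : CompactSpace (Mfd Γ))
    {Λ : ℕ → Subgroup Γ} (hanti : Antitone Λ) (hnormal : ∀ k, (Λ k).Normal)
    (hbot : ⨅ k, Λ k = ⊥) :
    Filter.Tendsto (fun k => injRad ((Λ k).map Γ.subtype)) Filter.atTop (𝓝 ⊤) := by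
  obtain ⟨R, hR⟩ := exists_trH_smul_le h
  refine ENNReal.tendsto_nhds_top_iff_nnreal.2 fun s => ?_
  filter_upwards [(Filter.eventually_all_finite
    (finite_setOf_trH_le Γ (R * (2 * Real.cosh ↑(s + 1))))).2
      fun γ _ => eventually_mem_imp_eq_one hanti hbot γ] with k hk
  exact (ENNReal.coe_lt_coe.2 (lt_add_one s)).trans_le
    (le_injRad_map_subtype hR (Λ k) (s + 1) fun γ hγ hP => hk γ hP hγ)

end InjectivityRadius

section Tower

variable {Γ : Subgroup PSL2C}

theorem betti1_Mfd_map_subtype_eq_zero [DiscreteTopology Γ]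
    (htf : ∀ g ∈ Γ, IsOfFinOrder g → g = 1) (N : Subgroup Γ)
    [Subsingleton (N →* Multiplicative ℚ)] : betti1 (Mfd (N.map Γ.subtype)) = 0 := by
  have hle : N.map Γ.subtype ≤ Γ := Subgroup.map_subtype_le N
  have : DiscreteTopology (N.map Γ.subtype) :=
    DiscreteTopology.of_subset (s := (Γ : Set PSL2C)) ‹_› hle
  have : Subsingleton (N.map Γ.subtype →* Multiplicative ℚ) :=
    (N.equivMapOfInjective Γ.subtype Γ.subtype_injective).monoidHomCongrLeftEquiv.symm.subsingleton
  exact betti1_eq_zero_of_subsingleton_character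
    (isQuotientCoveringMap_Mfd fun g hg => htf g (hle hg))

theorem exhaustedByRationalHomologySpheres_of_tower (hΓ : IsClosedHyperbolic Γ)
    {Λ : ℕ → Subgroup Γ} (h0 : Λ 0 = ⊤) (hanti : Antitone Λ) (hnormal : ∀ k, (Λ k).Normal)
    (hfin : ∀ k, (Λ k).FiniteIndex) (hbot : ⨅ k, Λ k = ⊥)
    (hchar : ∀ k, Subsingleton (Λ k →* Multiplicative ℚ)) :
    ExhaustedByRationalHomologySpheres Γ := by
  have := hΓ.discrete
  have hzero : (Λ 0).map Γ.subtype = Γ := by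
    rw [h0, ← MonoidHom.range_eq_map, Subgroup.range_subtype]
  have hindex : ∀ k, ((Λ k).map Γ.subtype).relIndex Γ ≠ 0 := fun k => by
    rw [Subgroup.relIndex, Subgroup.subgroupOf,
      Subgroup.comap_map_eq_self_of_injective Γ.subtype_injective]
    exact (hfin k).index_ne_zero
  exact ⟨fun k => (Λ k).map Γ.subtype, hzero, fun i j hij => Subgroup.map_mono (hanti hij),
    fun k => ⟨hindex k⟩, fun k => betti1_Mfd_map_subtype_eq_zero hΓ.torsionFree (Λ k),
    tendsto_injRad_map_subtype hΓ.compact hanti hnormal hbot⟩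

end Tower

theorem IsPPowerful.of_fundamentalGroup {E : Type*} {X G : Type} [TopologicalSpace E]
    [TopologicalSpace X] [PathConnectedSpace E] [Group G] [MulAction G E]
    {f : E → X} (hf : IsQuotientCoveringMap f G) {p : ℕ} {x : X}
    (hp : IsPPowerful p (FundamentalGroup X x)) : IsPPowerful p G := by
  obtain ⟨e, he⟩ := hf.surjective x
  exact hp.of_surjective
    (f := (MulEquiv.inv' G).symm.toMonoidHom.comp (hf.fundamentalGroupToMulOpposite ⟨e, he⟩))
    ((MulEquiv.inv' G).symm.surjective.comp (hf.fundamentalGroupToMulOpposite_surjective _))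

end HypMfd

open HypMfd in
theorem mainTheorem6 (Γ : Subgroup PSL2C) (hΓ : IsClosedHyperbolic Γ)
    (p n : ℕ) (hp : p.Prime) (hram : RamifiesAtPrimeOfNorm Γ (p ^ n))
    (hβ : betti1 (Mfd Γ) = 0)
    (hH1 : Nat.Coprime (Nat.card (H1 (Mfd Γ))) (p ^ (2 * n) - 1))
    (x₀ : Mfd Γ) (hpow : IsPPowerful p (FundamentalGroup (Mfd Γ) x₀)) :
    ExhaustedByRationalHomologySpheres Γ := by
  have := hΓ.discrete
  have : Fact p.Prime := ⟨hp⟩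
  have hcov := isQuotientCoveringMap_Mfd hΓ.torsionFree
  have : Group.FG Γ := fg_of_compactSpace_Mfd hΓ.compact
  have : Subsingleton (Γ →* Multiplicative ℚ) := subsingleton_character_of_betti1_eq_zero hcov hβ
  obtain ⟨Λ, hΛ, hbot⟩ :=
    exists_isPFiltration_of_ramifies hp.ne_zero hram hH1 (pow_card_H1_mem_commutator hcov)
  have hpowΓ : IsPPowerful p Γ := .of_fundamentalGroup hcov hpow
  refine exhaustedByRationalHomologySpheres_of_tower hΓ hΛ.zero_eq_top hΛ.antitone hΛ.normal
    (hΛ.finiteIndex hp.ne_zero) hbot fun k => ?_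
  have := hΛ.normal k
  have := hΛ.finiteIndex hp.ne_zero k
  exact hpowΓ.subsingleton_rationalCharacter
    (isPGroup_quotient_iff.2 fun g => ⟨k, hΛ.pow_pow_mem g k⟩)
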